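/- **Setting (Civ:V).** The map is an infinite hexagonal grid; there is one player and no limit on the number of turns. Each tile carries No Improvement, a Road or a Railroad. The player has two Workers, and in each turn each Worker waits, moves to an adjacent traversable tile not occupied by a Worker, or works on its tile. Roads and Railroads may be built on any tile and take $B_r\ge 1$ and $B_{rr}\ge 1$ turns of work; a Road can be built only on a tile with No Improvement, a Railroad only on a tile without a Railroad (possibly on a Road) and only if the player has the Engineering technology; removing a Road or Railroad takes one turn. Assume that the player has Engineering, that the map contains a two-way infinite strip of pairwise distinct, consecutively adjacent, traversable tiles (the tape), and that, disjoint from the strip, there is a connected traversable section of the map owned by the player with nine reserved tiles. **The machine.** Let $Q=\{0,\dots,9\}$ and $\Gamma=\{\text{No Improvement},\text{Road},\text{Railroad}\}$, abbreviated $0,1,b$, with blank symbol $0$ and start state $0$, and let $\delta$ be given by the following table. An entry $s\,D\,q'$ means: write $s$, move $D$, go to state $q'$. | state | read $0$ | read $1$ | read $b$ | |---|---|---|---| | 0 | $1\,R\,0$ | $0\,L\,1$ | $b\,R\,3$ | | 1 | $0\,L\,2$ | $0\,L\,1$ | $b\,L\,1$ | | 2 | $0\,L\,1$ | $b\,L\,5$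 | $b\,R\,0$ | | 3 | $1\,R\,0$ | $1\,R\,4$ | $1\,L\,3$ | | 4 | $b\,L\,2$ | $1\,R\,4$ | $b\,R\,4$ | | 5 | $1\,L\,6$ | $1\,L\,5$ | $b\,L\,5$ | | 6 | $0\,R\,7$ | halt | $b\,L\,8$ | | 7 | $1\,L\,5$ | $1\,R\,7$ | $b\,R\,7$ | | 8 | $1\,L\,9$ | $0\,R\,9$ | $0\,L\,3$ | | 9 | $0\,R\,4$ | $0\,R\,9$ | $b\,R\,8$ | As commands to the Workers, an entry $s\,D\,q'$ in state $q$ reads: the tape Worker leaves, builds or removes an improvement so that its tile carries $s$, then moves one tile along the strip in direction $D$; the state Worker builds $q'-q$ Railroads on the reserved tiles (removes $q-q'$ if this is negative). **Theorem 2.** (a) This is a $(10,3)$-UTM: it has $10$ states and $3$ symbols, and there are primitive recursive encoding and decoding functions such that, for every Turing machine $M$ and every input word $w$, the machine, started in state $0$ on the finite initial tape (with head position) that encodes $M$ and $w$, halts if and only if $M$ halts on $w$, and then the final state and tape of $M$ are decoded from its final tape and $M$. Under $0,1,b$, its program corresponds one-to-one to that of Rogozhin's $(10,3)$-UTM. (b)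 The game carries this machine with constant overhead. Say that a game position represents a configuration if the number of Railroads on the nine reserved tiles is the state, the improvements on the strip as seen from the tape Worker are the tape as seen from the head, the state Worker is on a reserved tile, and no work is unfinished. Every configuration is represented by some position. In a position that represents a configuration $C$, the table commands to halt if and only if the machine halts in $C$; otherwise the player can carry out the command in at most $4\max(B_r,B_{rr})+1+K$ turns, where $K$ depends only on the map, the strip, the section and the reserved tiles, and whenever the command has been carried out, with nothing else changed on the map, the position represents the successor of $C$. -/

import Mathlib

/-! ## Turing machines and universality -/

/-- A (deterministic, one-tape) Turing machine with states `Q` and tape symbols `Γ`. The blank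
symbol is `default : Γ`. A transition gives the next state, the symbol written and the move of the
head. The set of symbols allowed in inputs is not recorded: below, an input may be any finite word
over `Γ`. -/
structure TuringMachine (Q Γ : Type) [Inhabited Γ] where
  start : Q
  final : Set Q
  δ : Q → Γ → Option (Q × Γ × Turing.Dir)
  δ_final : ∀ q ∈ final, ∀ s, δ q s = none

namespace TuringMachine

/-- A configuration: the state and the two-way infinite tape as seen from the head. -/
structure Config (Q Γ : Type) [Inhabited Γ] where
  state : Q
  tape : Turing.Tape Γ

variable {Q Γ : Type} [Inhabited Γ]

/-- One step: write, then move. It is `none` exactly when the machine halts. -/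
def step (M : TuringMachine Q Γ) (C : Config Q Γ) : Option (Config Q Γ) :=
  (M.δ C.state C.tape.head).map fun a => ⟨a.1, (C.tape.write a.2.1).move a.2.2⟩

/-- The halting configuration reached from `C`, if there is one. -/
def run (M : TuringMachine Q Γ) (C : Config Q Γ) : Part (Config Q Γ) :=
  StateTransition.eval M.step C

/-- The start configuration with `l` to the left of the head (nearest cell first), and `r` from the
head on to the right. All other cells are blank. -/
def init (M : TuringMachine Q Γ) (l r : List Γ) : Config Q Γ :=
  ⟨M.start, Turing.Tape.mk₂ l r⟩

/-- Finite descriptions of Turing machines: number of states, number of symbols, start state, and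
the list of all instructions (state, read, write, move, next state), a move to the right being
`true`. -/
abbrev Description : Type := ℕ × ℕ × ℕ × List (ℕ × ℕ × ℕ × Bool × ℕ)

/-- Whether a move goes to the right. -/
def isRight : Turing.Dir → Bool
  | .left => false
  | .right => true

/-- The description of a machine with states `0, …, n` and symbols `0, …, k`. -/
def description {n k : ℕ} (M : TuringMachine (Fin (n + 1)) (Fin (k + 1))) : Description :=
  (n + 1, k + 1, M.start.val,
    (List.finRange (n + 1)).flatMap fun q => (List.finRange (k + 1)).filterMap fun s =>
      (M.δ q s).map fun a => (q.val, s.val, a.2.1.val, isRight a.2.2, a.1.val))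

/-- `U` is universal: it simulates every Turing machine `M` on every input word `w`, from a suitable
finite initial tape that depends on (the description of) `M` and on `w`. That is, `U` halts on this
tape if and only if `M` halts on `w`, and then the final configuration of `M` (state and tape) can
be read off from the final tape of `U`. The encoding and the decoding are uniform in `M` and
primitive recursive, so neither of them can do the work of `U`.

Every Turing machine is, up to names of states and symbols, one with states `0, …, n`, symbols
`0, …, k` and blank symbol `0`. -/
def IsUniversal [Primcodable Γ] (U : TuringMachine Q Γ) : Prop :=
  ∃ (enc : Description × List ℕ → List Γ × List Γ)
    (dec : Description × List Γ × List Γ → ℕ × List ℕ × List ℕ),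
    Primrec enc ∧ Primrec dec ∧
    ∀ (n k : ℕ) (M : TuringMachine (Fin (n + 1)) (Fin (k + 1))) (w : List (Fin (k + 1))),
      let code := enc (M.description, w.map Fin.val)
      ((U.run (U.init code.1 code.2)).Dom ↔ (M.run (M.init [] w)).Dom) ∧
      ∀ D ∈ M.run (M.init [] w), ∀ E ∈ U.run (U.init code.1 code.2),
        ∀ l r : List Γ, E.tape = Turing.Tape.mk₂ l r →
          ∃ l' r' : List (Fin (k + 1)), D.tape = Turing.Tape.mk₂ l' r' ∧
            dec (M.description, l, r) = (D.state.val, l'.map Fin.val, r'.map Fin.val)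

end TuringMachine

/-! ## The game -/

namespace CivV

/-- What the route layer of a tile may carry. -/
inductive Improvement
  | noImprovement
  | road
  | railroad
  deriving DecidableEq

instance : Inhabited Improvement := ⟨.noImprovement⟩

/-- The numbering of the three improvements. -/
def Improvement.equivFin : Improvement ≃ Fin 3 where
  toFun
    | .noImprovement => 0
    | .road => 1
    | .railroad => 2
  invFun
    | 0 => .noImprovement
    | 1 => .road
    | 2 => .railroad
  left_inv := by intro s; cases s <;> rfl
  right_inv := by intro i; fin_cases i <;> rfl

instance : Fintype Improvement := Fintype.ofEquiv (Fin 3) Improvement.equivFin.symm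

instance : Primcodable Improvement := Primcodable.ofEquiv (Fin 3) Improvement.equivFin

/-- The hexagonal tiles of a map that is infinite in all directions, in axial coordinates. -/
abbrev Tile : Type := ℤ × ℤ

/-- Two tiles share an edge. -/
def hexGraph : SimpleGraph Tile where
  Adj s t := t - s ∈ ({(1, 0), (-1, 0), (0, 1), (0, -1), (1, -1), (-1, 1)} : Set (ℤ × ℤ))
  symm := ⟨by
    intro s t h
    have e : s - t = -(t - s) := by abel
    simp only [Set.mem_insert_iff, Set.mem_singleton_iff] at h ⊢
    rw [e]
    rcases h with h | h | h | h | h | h <;> rw [h] <;> decide⟩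
  loopless := ⟨by
    intro s h
    simp [Prod.ext_iff] at h⟩

/-- The fixed data of the map: the tiles that Workers can enter, and those the player owns. -/
structure GameMap where
  traversable : Set Tile
  owned : Set Tile

/-- The fixed data of the single player's session: whether the Engineering technology is unlocked,
and the numbers of turns needed to build a Road and a Railroad. -/
structure Session where
  engineering : Prop
  roadTurns : ℕ
  railroadTurns : ℕ
  roadTurns_pos : 0 < roadTurns
  railroadTurns_pos : 0 < railroadTurns

/-- The two Workers. -/
inductive Worker
  | tape
  | state
  deriving DecidableEq

/-- A game position: the improvements on the map, the turns of work already invested in unfinished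
improvements, and the places of the Workers. -/
structure Position where
  improvement : Tile → Improvement
  progress : Tile → Improvement → ℕ
  worker : Worker → Tile

/-- What a Worker may be told to do in one turn. -/
inductive Order
  | wait
  | move (t : Tile)
  | build (i : Improvement)
  | remove

/-- The number of turns that it takes to build an improvement. -/
def Session.turns (S : Session) : Improvement → ℕ
  | .noImprovement => 0
  | .road => S.roadTurns
  | .railroad => S.railroadTurns

/-- The rules: a Worker moves to an adjacent traversable tile that no Worker occupies; Roads and
Railroads may be built anywhere, but a Road only on a tile without Road and Railroad, and a Railroad
only with Engineering and on a tile without Railroad; Roads and Railroads can be removed. -/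
def Legal (G : GameMap) (S : Session) (P : Position) (w : Worker) : Order → Prop
  | .wait => True
  | .move t => hexGraph.Adj (P.worker w) t ∧ t ∈ G.traversable ∧ ∀ v, P.worker v ≠ t
  | .build .noImprovement => False
  | .build .road => P.improvement (P.worker w) = .noImprovement
  | .build .railroad => S.engineering ∧ P.improvement (P.worker w) ≠ .railroad
  | .remove => P.improvement (P.worker w) ≠ .noImprovement

/-- The effect of one turn of a Worker. Building adds a turn of work, and finishes (replacing what
was there) once the required number of turns is reached; removing takes a single turn. -/
def act (S : Session) (P : Position) (w : Worker) : Order → Position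
  | .wait => P
  | .move t => { P with worker := Function.update P.worker w t }
  | .build i =>
    if P.progress (P.worker w) i + 1 < S.turns i then
      { P with
        progress := fun t j =>
          if t = P.worker w ∧ j = i then P.progress t j + 1 else P.progress t j }
    else
      { P with
        improvement := Function.update P.improvement (P.worker w) i
        progress := Function.update P.progress (P.worker w) 0 }
  | .remove =>
    { P with improvement := Function.update P.improvement (P.worker w) .noImprovement }

/-- A turn of the game: the player gives an order to each of the Workers. -/
def Turn (G : GameMap) (S : Session) (P P' : Position) : Prop :=
  ∃ o₁ o₂ : Order, Legal G S P .tape o₁ ∧ Legal G S (act S P .tape o₁) .state o₂ ∧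
    P' = act S (act S P .tape o₁) .state o₂

/-- `Play G S n P P'`: the player can get from `P` to `P'` in exactly `n` turns. -/
inductive Play (G : GameMap) (S : Session) : ℕ → Position → Position → Prop
  | nil (P : Position) : Play G S 0 P P
  | cons {n : ℕ} {P P' P'' : Position} : Turn G S P P' → Play G S n P' P'' → Play G S (n + 1) P P''

/-! ## The machine -/

/-- What the tape Worker is told to do with the tile it stands on. -/
inductive TapeOrder
  | keep
  | buildRoad
  | buildRailroad
  | remove

/-- What the tile carries after the order, in terms of what it carried before. -/
def TapeOrder.result : TapeOrder → Improvement → Improvement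
  | .keep, s => s
  | .buildRoad, _ => .road
  | .buildRailroad, _ => .railroad
  | .remove, _ => .noImprovement

/-- A command to the Workers: what the tape Worker does with its tile, where it moves then, and how
many Railroads the state Worker builds (negative: removes) on the reserved tiles. -/
structure Command where
  tape : TapeOrder
  dir : Turing.Dir
  change : ℤ

/-- The commands, by the number of Railroads on the reserved tiles and the improvement under the
tape Worker; `none` is the command to halt. -/
def commandTable : Fin 10 → Improvement → Option Command
  | 0, .noImprovement => some ⟨.buildRoad, .right, 0⟩
  | 0, .road => some ⟨.remove, .left, 1⟩
  | 0, .railroad => some ⟨.keep, .right, 3⟩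
  | 1, .noImprovement => some ⟨.keep, .left, 1⟩
  | 1, .road => some ⟨.remove, .left, 0⟩
  | 1, .railroad => some ⟨.keep, .left, 0⟩
  | 2, .noImprovement => some ⟨.keep, .left, -1⟩
  | 2, .road => some ⟨.buildRailroad, .left, 3⟩
  | 2, .railroad => some ⟨.keep, .right, -2⟩
  | 3, .noImprovement => some ⟨.buildRoad, .right, -3⟩
  | 3, .road => some ⟨.keep, .right, 1⟩
  | 3, .railroad => some ⟨.buildRoad, .left, 0⟩
  | 4, .noImprovement => some ⟨.buildRailroad, .left, -2⟩
  | 4, .road => some ⟨.keep, .right, 0⟩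
  | 4, .railroad => some ⟨.keep, .right, 0⟩
  | 5, .noImprovement => some ⟨.buildRoad, .left, 1⟩
  | 5, .road => some ⟨.keep, .left, 0⟩
  | 5, .railroad => some ⟨.keep, .left, 0⟩
  | 6, .noImprovement => some ⟨.keep, .right, 1⟩
  | 6, .road => none
  | 6, .railroad => some ⟨.keep, .left, 2⟩
  | 7, .noImprovement => some ⟨.buildRoad, .left, -2⟩
  | 7, .road => some ⟨.keep, .right, 0⟩
  | 7, .railroad => some ⟨.keep, .right, 0⟩
  | 8, .noImprovement => some ⟨.buildRoad, .left, 1⟩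
  | 8, .road => some ⟨.remove, .right, 1⟩
  | 8, .railroad => some ⟨.remove, .left, -5⟩
  | 9, .noImprovement => some ⟨.keep, .right, -5⟩
  | 9, .road => some ⟨.remove, .right, 0⟩
  | 9, .railroad => some ⟨.keep, .right, -1⟩

/-- The Turing machine with states `0, …, 9` (numbers of Railroads), symbols No Improvement (the
blank), Road and Railroad, and the transition function given by the commands. -/
def machine : TuringMachine (Fin 10) Improvement where
  start := 0
  final := ∅
  δ q s := (commandTable q s).map fun c =>
    (Fin.ofNat 10 ((q.val : ℤ) + c.change).toNat, c.tape.result s, c.dir)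
  δ_final := by simp

/-- The symbols of Rogozhin's machine. -/
inductive RSymbol
  | zero
  | one
  | b
  deriving DecidableEq

instance : Inhabited RSymbol := ⟨.zero⟩

/-- Rogozhin's program with ten states and three symbols, numbered from `0`. -/
def rogozhinProgram : Fin 10 → RSymbol → Option (Fin 10 × RSymbol × Turing.Dir)
  | 0, .zero => some (0, .one, .right)
  | 0, .one => some (1, .zero, .left)
  | 0, .b => some (3, .b, .right)
  | 1, .zero => some (2, .zero, .left)
  | 1, .one => some (1, .zero, .left)
  | 1, .b => some (1, .b, .left)
  | 2, .zero => some (1, .zero, .left)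
  | 2, .one => some (5, .b, .left)
  | 2, .b => some (0, .b, .right)
  | 3, .zero => some (0, .one, .right)
  | 3, .one => some (4, .one, .right)
  | 3, .b => some (3, .one, .left)
  | 4, .zero => some (2, .b, .left)
  | 4, .one => some (4, .one, .right)
  | 4, .b => some (4, .b, .right)
  | 5, .zero => some (6, .one, .left)
  | 5, .one => some (5, .one, .left)
  | 5, .b => some (5, .b, .left)
  | 6, .zero => some (7, .zero, .right)
  | 6, .one => none
  | 6, .b => some (8, .b, .left)
  | 7, .zero => some (5, .one, .left)
  | 7, .one => some (7, .one, .right)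
  | 7, .b => some (7, .b, .right)
  | 8, .zero => some (9, .one, .left)
  | 8, .one => some (9, .zero, .right)
  | 8, .b => some (3, .zero, .left)
  | 9, .zero => some (4, .zero, .right)
  | 9, .one => some (9, .zero, .right)
  | 9, .b => some (8, .b, .right)

/-- The correspondence of symbols. -/
def toRogozhin : Improvement → RSymbol
  | .noImprovement => .zero
  | .road => .one
  | .railroad => .b

/-! ## The machine in the game -/

/-- The parts of the map that are used: a two-way infinite strip of traversable tiles (the tape),
and, disjoint from it, a connected traversable area owned by the player with nine reserved tiles. -/
structure Layout (G : GameMap) where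
  strip : ℤ → Tile
  strip_injective : Function.Injective strip
  strip_adj : ∀ i, hexGraph.Adj (strip i) (strip (i + 1))
  strip_traversable : ∀ i, strip i ∈ G.traversable
  area : Set Tile
  area_owned : area ⊆ G.owned
  area_traversable : area ⊆ G.traversable
  area_connected : (hexGraph.induce area).Connected
  strip_notMem_area : ∀ i, strip i ∉ area
  reserved : Finset Tile
  reserved_subset : (reserved : Set Tile) ⊆ area
  reserved_card : reserved.card = 9

namespace Layout

variable {G : GameMap} (L : Layout G)

/-- The number of Railroads on the reserved tiles. -/
def railroads (P : Position) : ℕ :=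
  (L.reserved.filter fun t => P.improvement t = .railroad).card

theorem railroads_lt (P : Position) : L.railroads P < 10 := by
  have h := Finset.card_filter_le L.reserved fun t => P.improvement t = .railroad
  rw [L.reserved_card] at h
  exact Nat.lt_succ_of_le h

/-- The command that the table gives in a position. -/
def command (P : Position) : Option Command :=
  commandTable ⟨L.railroads P, L.railroads_lt P⟩ (P.improvement (P.worker .tape))

/-- The number of steps to the right made by a move along the strip. -/
def offset : Turing.Dir → ℤ
  | .left => -1
  | .right => 1

/-- The position `P` shows the configuration `C`: the state is the number of Railroads on the
reserved tiles, the strip as seen from the tape Worker is the tape, the state Worker is on a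
reserved tile, and no work is unfinished. -/
def Represents (C : TuringMachine.Config (Fin 10) Improvement) (P : Position) : Prop :=
  L.railroads P = C.state.val ∧
  (∃ p : ℤ, P.worker .tape = L.strip p ∧
    ∀ i : ℤ, P.improvement (L.strip (p + i)) = C.tape.nth i) ∧
  P.worker .state ∈ L.reserved ∧
  P.progress = 0

/-- From `P` to `P'`, the command `c` has been carried out, and nothing else has changed on the
map (only which of the reserved tiles carry the Railroads is left to the player). -/
def CarriesOut (c : Command) (P P' : Position) : Prop :=
  (∃ p : ℤ, P.worker .tape = L.strip p ∧
    P'.worker .tape = L.strip (p + offset c.dir) ∧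
    P'.improvement (L.strip p) = c.tape.result (P.improvement (L.strip p)) ∧
    ∀ t, t ≠ L.strip p → t ∉ L.reserved → P'.improvement t = P.improvement t) ∧
  (L.railroads P' : ℤ) = L.railroads P + c.change ∧
  P'.worker .state ∈ L.reserved ∧
  P'.progress = 0

end Layout

end CivV

/-! Universality is a chain of simulations that ends in a tag system removing two letters per step.
A described Turing machine is interpreted by a primitive recursive step function (`describedStep`),
so the map from an encoded description and input to the encoded halting configuration is partial
recursive. Mathlib compiles partial recursive functions to Turing machines with two symbols, whose
half tapes are two binary stacks, that is, two numbers (`exists_stackProgram_of_partrec`). A program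
on two numbers becomes a tag system (`TagLetter.tagReaches_word`): numbers are unary blocks with
fillers in every second place, a push doubles a block, and a pop learns the parity of a block from
whether the removal of letters in pairs leaves it in or out of phase.

The heart is that the machine runs such tag systems (`reaches_tagConfig`). To the left of the head
lie the productions, as runs of blanks separated by Railroads; to the right lies the word, letter
`i` being `2 * i + 1` Roads and two Railroads. A walk to the left in states 1 and 2 takes the parity
of each run and turns back behind the first odd one, so the runs fall into segments that end with an
odd run. Each erased Road of the first letter sends the head one segment further; with two segments
per production and two in front of all, the search stops exactly before production `i`
(`reaches_search`). What has been passed is filled with Roads. Then the two Railroads of the first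
letter are turned into Roads, which joins it to the second letter (`reaches_join`), the production
is copied run by run to the end of the word (`reaches_copy`), and on the way back to the word the
program is blanked again together with the joined letters (`reaches_restore`). These merge with the
first run of the program, whose length grows by an even number and is irrelevant. For the letter
without production the search ends at a Road at the left end, where the machine halts.

The result is read off by counting Railroads, which blanks at the ends of the tape do not affect:
the count is an affine function of the code of the output (`exists_machine_simulation`), and this
code is injective and not below its argument, so a bounded search inverts it.

In the game, a command costs at most one change of the tape tile, one move, and three Railroads
built or five removed. The walks between reserved tiles are bounded, since these are finitely many
tiles in a connected area (`Layout.exists_play_carriesOut`). -/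

theorem StateTransition.Reaches.step {σ : Type*} {f : σ → Option σ} {a b c : σ} (h : f a = some b)
    (hbc : Reaches f b c) : Reaches f a c :=
  Relation.ReflTransGen.head h hbc

theorem StateTransition.Reaches.trans {σ : Type*} {f : σ → Option σ} {a b c : σ}
    (hab : Reaches f a b) (hbc : Reaches f b c) : Reaches f a c :=
  Relation.ReflTransGen.trans hab hbc

theorem StateTransition.Reaches.refl {σ : Type*} {f : σ → Option σ} (a : σ) : Reaches f a a :=
  Relation.ReflTransGen.refl

/-! ## Runs of Turing machines between two halves of the tape -/

namespace TuringMachine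

open StateTransition Relation

variable {Q Γ : Type} [Inhabited Γ]

/-- The configuration whose tape is `l` (nearest cell first) followed by `r`, with the head on the
last cell of the left half. -/
def Config.onLeft (q : Q) (l r : List Γ) : Config Q Γ :=
  ⟨q, (Turing.Tape.mk₂ l r).move .left⟩

/-- The configuration whose tape is `l` (nearest cell first) followed by `r`, with the head on the
first cell of the right half. -/
def Config.onRight (q : Q) (l r : List Γ) : Config Q Γ :=
  ⟨q, Turing.Tape.mk₂ l r⟩

open Config

variable (M : TuringMachine Q Γ) {q q' : Q} {a b : Γ}

theorem mk₂_cons_write_move_right (l r : List Γ) (a b : Γ) :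
    ((Turing.Tape.mk₂ l (a :: r)).write b).move .right = Turing.Tape.mk₂ (b :: l) r := by
  simp [Turing.Tape.mk₂, Turing.Tape.mk', Turing.Tape.write, Turing.Tape.move]

theorem mk₂_cons_write_move_left (l r : List Γ) (a b : Γ) :
    ((Turing.Tape.mk₂ l (a :: r)).write b).move .left = (Turing.Tape.mk₂ l (b :: r)).move .left := by
  simp [Turing.Tape.mk₂, Turing.Tape.mk', Turing.Tape.write, Turing.Tape.move]

theorem mk₂_move_left (l r : List Γ) (a : Γ) :
    (Turing.Tape.mk₂ (a :: l) r).move .left = Turing.Tape.mk₂ l (a :: r) := by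
  simp [Turing.Tape.mk₂]

theorem onRight_nil (q : Q) (l : List Γ) :
    onRight q l [] = onRight q l [default] := by
  unfold onRight
  congr 1

variable {M}

theorem step_onRight_right (h : M.δ q a = some (q', b, .right)) (l r : List Γ) :
    M.step (onRight q l (a :: r)) = some (onRight q' (b :: l) r) := by
  have : (Turing.Tape.mk₂ l (a :: r)).head = a := by simp [Turing.Tape.mk₂, Turing.Tape.mk']
  simp [step, onRight, this, h, mk₂_cons_write_move_right]

theorem step_onRight_left (h : M.δ q a = some (q', b, .left)) (l r : List Γ) :
    M.step (onRight q l (a :: r)) = some (onLeft q' l (b :: r)) := by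
  have : (Turing.Tape.mk₂ l (a :: r)).head = a := by simp [Turing.Tape.mk₂, Turing.Tape.mk']
  simp [step, onRight, onLeft, this, h, mk₂_cons_write_move_left]

theorem onLeft_cons (q : Q) (l r : List Γ) (a : Γ) :
    onLeft q (a :: l) r = onRight q l (a :: r) := by
  simp [onLeft, onRight, mk₂_move_left]

theorem step_onLeft_right (h : M.δ q a = some (q', b, .right)) (l r : List Γ) :
    M.step (onLeft q (a :: l) r) = some (onRight q' (b :: l) r) := by
  rw [onLeft_cons, step_onRight_right h]

theorem step_onLeft_left (h : M.δ q a = some (q', b, .left)) (l r : List Γ) :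
    M.step (onLeft q (a :: l) r) = some (onLeft q' l (b :: r)) := by
  rw [onLeft_cons, step_onRight_left h]

/-- Sweep to the right in one state, rewriting every symbol by `g`. -/
theorem reaches_sweep_right (g : Γ → Γ) (s : List Γ)
    (h : ∀ a ∈ s, M.δ q a = some (q, g a, .right)) (l r : List Γ) :
    Reaches M.step (onRight q l (s ++ r)) (onRight q ((s.map g).reverse ++ l) r) := by
  induction s generalizing l with
  | nil => exact .refl _
  | cons a s ih =>
    refine Reaches.step (step_onRight_right (h a (by simp)) _ _) ?_
    simpa using ih (fun a ha => h a (by simp [ha])) (g a :: l)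

/-- Sweep to the left in one state, rewriting every symbol by `g`. -/
theorem reaches_sweep_left (g : Γ → Γ) (s : List Γ)
    (h : ∀ a ∈ s, M.δ q a = some (q, g a, .left)) (l r : List Γ) :
    Reaches M.step (onLeft q (s ++ l) r) (onLeft q l ((s.map g).reverse ++ r)) := by
  induction s generalizing r with
  | nil => exact .refl _
  | cons a s ih =>
    refine Reaches.step (step_onLeft_left (h a (by simp)) _ _) ?_
    simpa using ih (fun a ha => h a (by simp [ha])) (g a :: r)

end TuringMachine

/-! ## Simulation of transition systems -/

namespace StateTransition

open Relation

variable {σ τ : Type*} {f : σ → Option σ} {g : τ → Option τ} {R F : σ → τ → Prop}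

/-- If every step of `f` is followed by at least one step of `g`, and `g` halts after `f` does, then
`g` reaches a halting configuration whenever `f` does. -/
theorem exists_mem_eval_of_simulation
    (hs : ∀ a c, R a c → ∀ a', f a = some a' → ∃ c', R a' c' ∧ Reaches₁ g c c')
    (hn : ∀ a c, R a c → f a = none → ∃ c', Reaches g c c' ∧ g c' = none ∧ F a c')
    {a : σ} {c : τ} (hR : R a c) {b : σ} (hb : b ∈ eval f a) : ∃ d ∈ eval g c, F b d := by
  obtain ⟨hab, hb'⟩ := mem_eval.1 hb
  have : ∃ d, Reaches g c d ∧ R b d := by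
    clear hb hb'
    induction hab with
    | refl => exact ⟨c, .refl _, hR⟩
    | tail _ h ih =>
      obtain ⟨d, hcd, hd⟩ := ih
      obtain ⟨d', hd', h'⟩ := hs _ _ hd _ h
      exact ⟨d', hcd.trans h'.to_reflTransGen, hd'⟩
  obtain ⟨d, hcd, hd⟩ := this
  obtain ⟨d', hdd, hn, hF⟩ := hn _ _ hd hb'
  exact ⟨d', mem_eval.2 ⟨hcd.trans hdd, hn⟩, hF⟩

/-- Each step of `f` uses up at least one step of the deterministic `g`, so `f` cannot outlast a
halting run of `g`. The induction runs along that run of `g`; its current point `e` may lie before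
the configuration `c` related to `a`, since one step of `f` may match many steps of `g`. -/
theorem eval_dom_of_simulation
    (hs : ∀ a c, R a c → ∀ a', f a = some a' → ∃ c', R a' c' ∧ Reaches₁ g c c')
    {a : σ} {c : τ} (hR : R a c) (hc : (eval g c).Dom) : (eval f a).Dom := by
  obtain ⟨d, hd⟩ := Part.dom_iff_mem.1 hc
  suffices ∀ e, Reaches g e d → ∀ a c, R a c → Reaches g e c → (eval f a).Dom from
    this c (mem_eval.1 hd).1 a c hR (.refl _)
  have hd0 := (mem_eval.1 hd).2
  intro e he
  induction he using ReflTransGen.head_induction_on with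
  | refl =>
    intro a c hR hc
    rcases ReflTransGen.cases_head hc with rfl | ⟨x, hx, -⟩
    · cases h : f a with
      | none => exact Part.dom_iff_mem.2 ⟨a, mem_eval.2 ⟨.refl _, h⟩⟩
      | some a' =>
        obtain ⟨c', -, hc'⟩ := hs _ _ hR _ h
        obtain ⟨x, hx, -⟩ := TransGen.head'_iff.1 hc'
        rw [Option.mem_def, hd0] at hx
        cases hx
    · rw [Option.mem_def, hd0] at hx
      cases hx
  | head h _ ih =>
    intro a c hR hc
    rcases ReflTransGen.cases_head hc with rfl | ⟨x, hx, hxc⟩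
    · cases h' : f a with
      | none => exact Part.dom_iff_mem.2 ⟨a, mem_eval.2 ⟨.refl _, h'⟩⟩
      | some a' =>
        obtain ⟨c', hR', hc'⟩ := hs _ _ hR _ h'
        obtain ⟨x, hx, hxc⟩ := TransGen.head'_iff.1 hc'
        cases Option.mem_unique h hx
        have := ih _ _ hR' hxc
        rw [reaches_eval (ReflTransGen.single h')]
        exact this
    · cases Option.mem_unique h hx
      exact ih _ _ hR hxc

end StateTransition

/-! ## The program of the machine -/

namespace CivV

open StateTransition TuringMachine TuringMachine.Config List

local notation "▢" => Improvement.noImprovement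
local notation "◫" => Improvement.road
local notation "■" => Improvement.railroad

theorem δ_0_0 : machine.δ 0 ▢ = some (0, ◫, .right) := rfl
theorem δ_0_1 : machine.δ 0 ◫ = some (1, ▢, .left) := rfl
theorem δ_0_b : machine.δ 0 ■ = some (3, ■, .right) := rfl
theorem δ_1_0 : machine.δ 1 ▢ = some (2, ▢, .left) := rfl
theorem δ_1_1 : machine.δ 1 ◫ = some (1, ▢, .left) := rfl
theorem δ_1_b : machine.δ 1 ■ = some (1, ■, .left) := rfl
theorem δ_2_0 : machine.δ 2 ▢ = some (1, ▢, .left) := rfl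
theorem δ_2_1 : machine.δ 2 ◫ = some (5, ■, .left) := rfl
theorem δ_2_b : machine.δ 2 ■ = some (0, ■, .right) := rfl
theorem δ_3_0 : machine.δ 3 ▢ = some (0, ◫, .right) := rfl
theorem δ_3_1 : machine.δ 3 ◫ = some (4, ◫, .right) := rfl
theorem δ_3_b : machine.δ 3 ■ = some (3, ◫, .left) := rfl
theorem δ_4_0 : machine.δ 4 ▢ = some (2, ■, .left) := rfl
theorem δ_4_1 : machine.δ 4 ◫ = some (4, ◫, .right) := rfl
theorem δ_4_b : machine.δ 4 ■ = some (4, ■, .right) := rfl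
theorem δ_5_0 : machine.δ 5 ▢ = some (6, ◫, .left) := rfl
theorem δ_5_1 : machine.δ 5 ◫ = some (5, ◫, .left) := rfl
theorem δ_5_b : machine.δ 5 ■ = some (5, ■, .left) := rfl
theorem δ_6_0 : machine.δ 6 ▢ = some (7, ▢, .right) := rfl
theorem δ_6_b : machine.δ 6 ■ = some (8, ■, .left) := rfl
theorem δ_7_0 : machine.δ 7 ▢ = some (5, ◫, .left) := rfl
theorem δ_7_1 : machine.δ 7 ◫ = some (7, ◫, .right) := rfl
theorem δ_7_b : machine.δ 7 ■ = some (7, ■, .right) := rfl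
theorem δ_8_0 : machine.δ 8 ▢ = some (9, ◫, .left) := rfl
theorem δ_8_1 : machine.δ 8 ◫ = some (9, ▢, .right) := rfl
theorem δ_8_b : machine.δ 8 ■ = some (3, ▢, .left) := rfl
theorem δ_9_0 : machine.δ 9 ▢ = some (4, ▢, .right) := rfl
theorem δ_9_1 : machine.δ 9 ◫ = some (9, ▢, .right) := rfl
theorem δ_9_b : machine.δ 9 ■ = some (8, ■, .right) := rfl

/-! ## Searching for the production of a letter -/

/-- Runs of `k + 1` cells with the symbol `s`, for `k` in `ks`, each followed by a Railroad. -/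
def runs (s : Improvement) (ks : List ℕ) : List Improvement :=
  ks.flatMap fun k => replicate (k + 1) s ++ [■]

@[simp] theorem runs_nil (s : Improvement) : runs s [] = [] := rfl

@[simp] theorem runs_cons (s : Improvement) (k : ℕ) (ks : List ℕ) :
    runs s (k :: ks) = replicate (k + 1) s ++ ■ :: runs s ks := by
  simp [runs]

@[simp] theorem runs_append (s : Improvement) (ks ks' : List ℕ) :
    runs s (ks ++ ks') = runs s ks ++ runs s ks' := by
  simp [runs]

theorem mem_runs {s a : Improvement} {ks : List ℕ} (h : a ∈ runs s ks) : a = s ∨ a = ■ := by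
  simp only [runs, mem_flatMap, mem_append, mem_replicate, mem_singleton] at h
  tauto

/-- Exchange No Improvement and Road. -/
def flip : Improvement → Improvement
  | .noImprovement => ◫
  | .road => ▢
  | .railroad => ■

theorem map_flip_runs_road (ks : List ℕ) : (runs ◫ ks).map flip = runs ▢ ks := by
  induction ks <;> simp_all [flip]

theorem reaches_erase_left (c : ℕ) (ks : List ℕ) (l r : List Improvement) :
    Reaches machine.step (onLeft 1 (replicate c ◫ ++ runs ◫ ks ++ l) r)
      (onLeft 1 l ((replicate c ▢ ++ runs ▢ ks).reverse ++ r)) := by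
  have h := reaches_sweep_left (M := machine) (q := 1) flip (replicate c ◫ ++ runs ◫ ks)
    (fun a ha => by
      rcases mem_append.1 ha with ha | ha
      · rw [(mem_replicate.1 ha).2]; exact δ_1_1
      · rcases mem_runs ha with rfl | rfl
        · exact δ_1_1
        · exact δ_1_b) l r
  simpa [map_flip_runs_road, flip] using h

theorem reaches_fill (c : ℕ) (l r : List Improvement) :
    Reaches machine.step (onRight 0 l (replicate c ▢ ++ r)) (onRight 0 (replicate c ◫ ++ l) r) := by
  have h := reaches_sweep_right (M := machine) (q := 0) flip (replicate c ▢)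
    (fun a ha => by rw [(mem_replicate.1 ha).2]; exact δ_0_0) l r
  simpa [flip] using h

/-- A Railroad takes state 0 to state 3, which fills one blank and returns to state 0. So every run
needs at least one cell: two adjacent Railroads would start the other branch of state 3, which is
used in `reaches_join`. -/
theorem reaches_fill_run (k : ℕ) (l r : List Improvement) :
    Reaches machine.step (onRight 0 l (■ :: (replicate (k + 1) ▢ ++ r)))
      (onRight 0 (replicate (k + 1) ◫ ++ ■ :: l) r) := by
  rw [replicate_succ, cons_append]
  refine .step (step_onRight_right δ_0_b _ _) (.step (step_onRight_right δ_3_0 _ _) ?_)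
  convert reaches_fill k (◫ :: ■ :: l) r using 2
  simp [replicate_succ']

/-- This undoes `reaches_erase_left`: a round trip to the next segment leaves the part already
passed as it was. -/
theorem reaches_fill_right (c : ℕ) (ks : List ℕ) (l r : List Improvement) :
    Reaches machine.step (onRight 0 l ((replicate c ▢ ++ runs ▢ ks).reverse ++ r))
      (onRight 0 (replicate c ◫ ++ runs ◫ ks ++ l) r) := by
  have key : ∀ r, Reaches machine.step (onRight 0 l ((runs ▢ ks).reverse ++ r))
      (onRight 0 (runs ◫ ks ++ l) r) := by
    induction ks with
    | nil => intro r; exact .refl _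
    | cons k ks ih =>
      intro r
      convert (ih (■ :: (replicate (k + 1) ▢ ++ r))).trans (reaches_fill_run k _ r) using 2
      all_goals simp
  rw [reverse_append, append_assoc, append_assoc]
  refine (key _).trans ?_
  simpa using reaches_fill c (runs ◫ ks ++ l) r

/-- States 1 and 2 alternate on blanks. At a Railroad, state 1 goes on to the left (even run) and
state 2 turns round (odd run). -/
theorem reaches_cross_even (j : ℕ) (l r : List Improvement) :
    Reaches machine.step (onLeft 1 (replicate (2 * j) ▢ ++ l) r)
      (onLeft 1 l (replicate (2 * j) ▢ ++ r)) := by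
  induction j generalizing r with
  | zero => exact .refl _
  | succ j ih =>
    rw [Nat.mul_succ, replicate_succ, replicate_succ, cons_append, cons_append]
    refine .step (step_onLeft_left δ_1_0 _ _) (.step (step_onLeft_left δ_2_0 _ _) ?_)
    convert ih (▢ :: ▢ :: r) using 2
    rw [← replicate_succ, ← replicate_succ, replicate_succ', replicate_succ']
    simp

/-- The runs of a segment of the program: runs of even length, up to and including the first one of
odd length. -/
def segmentRuns (s : List ℕ × ℕ) : List ℕ :=
  s.1.map (fun j => 2 * j + 1) ++ [2 * s.2]

/-- The head passes a segment to the left, turns at its end and comes back. -/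
theorem reaches_pass_segment (s : List ℕ × ℕ) (l r : List Improvement) :
    Reaches machine.step (onLeft 1 (runs ▢ (segmentRuns s) ++ l) r)
      (onRight 0 (runs ◫ (segmentRuns s) ++ l) r) := by
  obtain ⟨js, k⟩ := s
  induction js generalizing r with
  | nil =>
    have h := reaches_cross_even k (▢ :: ■ :: l) r
    refine .trans (b := onLeft 1 (▢ :: ■ :: l) (replicate (2 * k) ▢ ++ r)) ?_ ?_
    · convert h using 2
      simp [segmentRuns, replicate_succ']
    refine .step (step_onLeft_left δ_1_0 _ _) (.step (step_onLeft_right δ_2_b _ _) ?_)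
    convert reaches_fill (2 * k + 1) (■ :: l) r using 2 <;> simp [segmentRuns, replicate_succ]
  | cons j js ih =>
    have h := reaches_cross_even (j + 1) (■ :: (runs ▢ (segmentRuns (js, k)) ++ l)) r
    refine .trans (b := onLeft 1 (■ :: (runs ▢ (segmentRuns (js, k)) ++ l))
      (replicate (2 * (j + 1)) ▢ ++ r)) ?_ (.step (step_onLeft_left δ_1_b _ _) ?_)
    · convert h using 2
      simp [segmentRuns, Nat.mul_succ]
    · refine (ih _).trans ?_
      convert reaches_fill_run (2 * j + 1) (runs ◫ (segmentRuns (js, k)) ++ l) r using 2 <;>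
        simp [segmentRuns, Nat.mul_succ]

/-- Every Road that the head erases moves it on by one segment. -/
theorem reaches_pass_segments (S : List (List ℕ × ℕ)) (c : ℕ) (ks : List ℕ)
    (l r : List Improvement) :
    Reaches machine.step
      (onRight 0 (replicate c ◫ ++ runs ◫ ks ++ runs ▢ (S.flatMap segmentRuns) ++ l)
        (replicate S.length ◫ ++ r))
      (onRight 0 (replicate (c + S.length) ◫ ++ runs ◫ (ks ++ S.flatMap segmentRuns) ++ l) r) := by
  induction S generalizing c ks with
  | nil => convert! Reaches.refl _ using 2; simp
  | cons s S ih =>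
    rw [length_cons, replicate_succ, cons_append]
    refine .step (step_onRight_left δ_0_1 _ _) ?_
    have h₁ := reaches_erase_left c ks
      (runs ▢ (segmentRuns s) ++ (runs ▢ (S.flatMap segmentRuns) ++ l))
      (▢ :: (replicate S.length ◫ ++ r))
    have h₂ := reaches_fill_right c ks (runs ◫ (segmentRuns s) ++
      (runs ▢ (S.flatMap segmentRuns) ++ l)) (▢ :: (replicate S.length ◫ ++ r))
    have h₃ := ih (c + 1) (ks ++ segmentRuns s)
    refine .trans ?_ (.trans (h₁.trans ((reaches_pass_segment s _ _).trans h₂)) ?_)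
    · convert! Reaches.refl _ using 2; simp
    · refine .step (step_onRight_right δ_0_0 _ _) ?_
      convert h₃ using 2
      · simp [replicate_succ]
      · simp [Nat.add_assoc, Nat.add_comm 1]

/-- The head finds the production of a letter with code `replicate n ◫`. -/
theorem reaches_search (S : List (List ℕ × ℕ)) (n : ℕ) (hS : S.length = n + 1)
    (l r : List Improvement) :
    Reaches machine.step
      (onLeft 1 (runs ▢ (S.flatMap segmentRuns) ++ l) (▢ :: ▢ :: ▢ :: (replicate n ◫ ++ r)))
      (onRight 0 (replicate (n + 3) ◫ ++ runs ◫ (S.flatMap segmentRuns) ++ l) r) := by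
  obtain _ | ⟨s, S⟩ := S
  · simp at hS
  obtain rfl : S.length = n := by simpa using hS
  -- The head starts in state 1, so one segment is passed before any Road of the letter is erased;
  -- hence `n + 1` segments. On the way back the three blanks before the letter are filled too.
  have h₁ := reaches_pass_segment s (runs ▢ (S.flatMap segmentRuns) ++ l)
    (replicate 3 ▢ ++ (replicate S.length ◫ ++ r))
  have h₂ := reaches_fill 3 (runs ◫ (segmentRuns s) ++ (runs ▢ (S.flatMap segmentRuns) ++ l))
    (replicate S.length ◫ ++ r)
  have h₃ := reaches_pass_segments S 3 (segmentRuns s) l r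
  refine .trans ?_ ((h₁.trans h₂).trans ?_)
  · convert! Reaches.refl _ using 2; simp
  · convert h₃ using 2
    · simp
    · simp [Nat.add_comm]

/-! ## Copying a production -/

/-- Lists without No Improvement. -/
def Filled (F : List Improvement) : Prop := ∀ a ∈ F, a ≠ ▢

@[simp] theorem filled_nil : Filled [] := by simp [Filled]

@[simp] theorem filled_cons (a : Improvement) (F : List Improvement) :
    Filled (a :: F) ↔ a ≠ ▢ ∧ Filled F := by simp [Filled]

@[simp] theorem filled_append (F F' : List Improvement) :
    Filled (F ++ F') ↔ Filled F ∧ Filled F' := by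
  simp only [Filled, mem_append]
  exact ⟨fun h => ⟨fun a ha => h a (.inl ha), fun a ha => h a (.inr ha)⟩,
    fun h a ha => ha.elim (h.1 a) (h.2 a)⟩

@[simp] theorem filled_reverse (F : List Improvement) : Filled F.reverse ↔ Filled F := by
  simp [Filled]

@[simp] theorem filled_replicate (k : ℕ) : Filled (replicate k ◫) := by
  intro a ha
  simp [(mem_replicate.1 ha).2]

@[simp] theorem filled_runs (ks : List ℕ) : Filled (runs ◫ ks) := by
  intro a ha
  rcases mem_runs ha with rfl | rfl <;> simp

theorem reaches_cross_left {F : List Improvement} (hF : Filled F) (l r : List Improvement) :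
    Reaches machine.step (onLeft 5 (F.reverse ++ l) r) (onLeft 5 l (F ++ r)) := by
  have h := reaches_sweep_left (M := machine) (q := 5) id F.reverse (fun a ha => by
    have := hF a (by simpa using ha)
    cases a
    · exact absurd rfl this
    · exact δ_5_1
    · exact δ_5_b) l r
  simpa using h

/-- The last letter of the word is completed. -/
theorem reaches_close {F : List Improvement} (hF : Filled F) (l : List Improvement) :
    Reaches machine.step (onRight 4 l (F ++ [◫])) (onLeft 5 l (F ++ [■, ■])) := by
  have h := reaches_sweep_right (M := machine) (q := 4) id (F ++ [◫]) (fun a ha => by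
    have : a ≠ ▢ := (filled_append F [◫]).2 ⟨hF, by simp⟩ a ha
    cases a
    · exact absurd rfl this
    · exact δ_4_1
    · exact δ_4_b) l []
  -- Behind the last cell the tape is blank: state 4 puts a Railroad there, and state 2 turns the
  -- open Road before it into the other one.
  rw [append_nil, onRight_nil] at h
  refine h.trans (.step (step_onRight_left δ_4_0 _ _) ?_)
  simp only [map_id, reverse_append, reverse_cons, reverse_nil, nil_append, cons_append]
  exact .step (step_onLeft_left δ_2_1 _ _) (reaches_cross_left hF _ _)

/-- A Road is appended to the word. -/
theorem reaches_append_road {F : List Improvement} (hF : Filled F) (l : List Improvement) :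
    Reaches machine.step (onRight 7 l F) (onLeft 5 l (F ++ [◫])) := by
  have h := reaches_sweep_right (M := machine) (q := 7) id F (fun a ha => by
    have : a ≠ ▢ := hF a ha
    cases a
    · exact absurd rfl this
    · exact δ_7_1
    · exact δ_7_b) l []
  rw [append_nil, onRight_nil] at h
  refine h.trans (.step (step_onRight_left δ_7_0 _ _) ?_)
  simp only [map_id]
  exact reaches_cross_left hF _ _

/-- The codes of the first two letters are joined, and the last letter is completed. -/
theorem reaches_join {U F : List Improvement} (hU : Filled U) (hF : Filled F)
    (l : List Improvement) :
    Reaches machine.step (onRight 0 (◫ :: (U ++ l)) (■ :: ■ :: (F ++ [◫])))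
      (onLeft 5 l (U.reverse ++ ◫ :: ◫ :: ◫ :: (F ++ [■, ■]))) := by
  -- State 3 meets the second of two adjacent Railroads, turns both into Roads while moving left,
  -- and bounces off the Road before them into state 4.
  refine .step (step_onRight_right δ_0_b _ _) (.step (step_onRight_left δ_3_b _ _)
    (.step (step_onLeft_left δ_3_b _ _) (.step (step_onLeft_right δ_3_1 _ _) ?_)))
  have h₁ := reaches_close (F := ◫ :: ◫ :: F) (by simpa using hF) (◫ :: (U ++ l))
  have h₂ := reaches_cross_left (F := U.reverse ++ [◫]) (by simpa using hU) l
    (◫ :: ◫ :: F ++ [■, ■])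
  refine h₁.trans ?_
  simpa using h₂

theorem replicate_append_cons_self {α : Type*} (k : ℕ) (a : α) (l : List α) :
    replicate k a ++ a :: l = a :: (replicate k a ++ l) := by
  rw [append_cons, ← replicate_succ', replicate_succ, cons_append]

/-- Every blank but the last becomes a Road and sends one Road to the end of the word. State 6 looks
one cell ahead: only if that cell is blank does state 7 carry a Road to the right. The last blank,
next to a Railroad, is thus left to the test in `reaches_copy`. -/
theorem reaches_copy_run (k : ℕ) {F : List Improvement} (hF : Filled F) (l : List Improvement) :
    Reaches machine.step (onLeft 5 (replicate (k + 1) ▢ ++ l) F)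
      (onLeft 5 (▢ :: l) (replicate k ◫ ++ F ++ replicate k ◫)) := by
  induction k generalizing F with
  | zero => simpa using Reaches.refl _
  | succ k ih =>
    rw [replicate_succ, replicate_succ, cons_append, cons_append]
    refine .step (step_onLeft_left δ_5_0 _ _) (.step (step_onLeft_right δ_6_0 _ _) ?_)
    refine (reaches_append_road (by simpa using hF) _).trans ?_
    rw [← cons_append, ← replicate_succ]
    convert ih (F := ◫ :: F ++ [◫]) (by simpa using hF) using 2
    simp [replicate_succ, replicate_append_cons_self]

/-- The code of a letter: its number in unary, followed by two Railroads. -/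
def letterCode (i : ℕ) : List Improvement := replicate (2 * i + 1) ◫ ++ [■, ■]

/-- The code of a word. The last letter is left open: a Road stands for its two Railroads. -/
def openCode : List ℕ → List Improvement
  | [] => []
  | [i] => replicate (2 * i + 2) ◫
  | i :: j :: w => letterCode i ++ openCode (j :: w)

/-- Open and closed code have a common part `F` and differ only at the end, one Road against two
Railroads; this is the form in which `reaches_join` closes a word. -/
theorem exists_openCode_eq (i : ℕ) (w : List ℕ) :
    ∃ F, Filled F ∧ openCode (i :: w) = F ++ [◫] ∧ (i :: w).flatMap letterCode = F ++ [■, ■] := by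
  induction w generalizing i with
  | nil =>
    exact ⟨replicate (2 * i + 1) ◫, by simp, by simp [openCode, replicate_succ'],
      by simp [letterCode]⟩
  | cons j w ih =>
    obtain ⟨F, h₁, h₂, h₃⟩ := ih j
    refine ⟨letterCode i ++ F, by simpa [letterCode] using h₁, ?_, ?_⟩
    · rw [openCode, h₂, append_assoc]
    · rw [flatMap_cons, h₃, append_assoc]

theorem openCode_append (w : List ℕ) (i : ℕ) (w' : List ℕ) :
    openCode (w ++ i :: w') = w.flatMap letterCode ++ openCode (i :: w') := by
  induction w with
  | nil => rfl
  | cons j w ih =>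
    rw [flatMap_cons, append_assoc, ← ih]
    cases w <;> rfl

/-- The runs of the production of a letter, which are copied by the machine. -/
def copyRuns (i : ℕ) (w : List ℕ) : List ℕ := (2 * i + 2) :: w.map fun j => 2 * j + 3

/-- Behind a copied run, state 8 fills the first blank of the next one and state 9 looks at the cell
after it. A blank means that another letter follows, and the current one is closed; a Railroad means
that the run was the single blank that ends the production. The blank spent on this test is why the
later runs in `copyRuns` are one cell longer than the first would be. -/
theorem reaches_copy (i : ℕ) (w : List ℕ) {F : List Improvement} (hF : Filled F)
    (l : List Improvement) :
    Reaches machine.step (onLeft 5 (runs ▢ (copyRuns i w) ++ ▢ :: ■ :: l) F)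
      (onRight 8 (■ :: l) (◫ :: ((runs ◫ (copyRuns i w)).reverse ++ F ++ openCode (i :: w)))) := by
  induction w generalizing i F with
  | nil =>
    have h := reaches_copy_run (2 * i + 2) hF (■ :: ▢ :: ■ :: l)
    refine .trans ?_ (h.trans (.step (step_onLeft_left δ_5_0 _ _) (.step (step_onLeft_left δ_6_b _ _)
      (.step (step_onLeft_left δ_8_0 _ _) (.step (step_onLeft_right δ_9_b _ _) ?_)))))
    · convert! Reaches.refl _ using 2; simp [copyRuns]
    · convert! Reaches.refl _ using 2; simp [copyRuns, openCode, replicate_succ, replicate_append_cons_self]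
  | cons j w ih =>
    have h := reaches_copy_run (2 * i + 2) hF (■ :: ▢ :: ▢ :: (replicate (2 * j + 2) ▢ ++
      ■ :: (runs ▢ (w.map fun j => 2 * j + 3) ++ ▢ :: ■ :: l)))
    refine .trans ?_ (h.trans (.step (step_onLeft_left δ_5_0 _ _) (.step (step_onLeft_left δ_6_b _ _)
      (.step (step_onLeft_left δ_8_0 _ _) (.step (step_onLeft_right δ_9_0 _ _) ?_)))))
    · convert! Reaches.refl _ using 2; simp [copyRuns, replicate_succ]
    have h₂ := reaches_close (F := ◫ :: ■ :: ◫ :: (replicate (2 * i + 2) ◫ ++ F ++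
      replicate (2 * i + 1) ◫)) (by simpa using hF) (▢ :: (replicate (2 * j + 2) ▢ ++
      ■ :: (runs ▢ (w.map fun j => 2 * j + 3) ++ ▢ :: ■ :: l)))
    refine .trans ?_ (h₂.trans ?_)
    · convert! Reaches.refl _ using 2; simp [replicate_succ']
    refine .trans ?_ ((ih j (F := ◫ :: ■ :: ◫ :: (replicate (2 * i + 2) ◫ ++ F ++
      replicate (2 * i + 1) ◫ ++ [■, ■])) (by simpa using hF)).trans ?_)
    · convert! Reaches.refl _ using 2; simp [copyRuns, replicate_succ]
    · convert! Reaches.refl _ using 2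
      simp [copyRuns, openCode, letterCode, replicate_succ, replicate_append_cons_self]

/-! ## Restoring the program -/

theorem reaches_erase (c : ℕ) (l r : List Improvement) :
    Reaches machine.step (onRight 9 l (replicate c ◫ ++ r)) (onRight 9 (replicate c ▢ ++ l) r) := by
  have h := reaches_sweep_right (M := machine) (q := 9) flip (replicate c ◫)
    (fun a ha => by rw [(mem_replicate.1 ha).2]; exact δ_9_1) l r
  simpa [flip] using h

/-- State 8 inspects the cell after a Railroad. A Road there means that the program goes on; a
second Railroad, as in `reaches_restore`, is the end of the joined letters. -/
theorem reaches_erase_run (k : ℕ) (l r : List Improvement) :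
    Reaches machine.step (onRight 9 l (■ :: (replicate (k + 1) ◫ ++ r)))
      (onRight 9 (replicate (k + 1) ▢ ++ ■ :: l) r) := by
  rw [replicate_succ, cons_append]
  refine .step (step_onRight_right δ_9_b _ _) (.step (step_onRight_right δ_8_1 _ _) ?_)
  convert reaches_erase k (▢ :: ■ :: l) r using 2
  simp [replicate_succ, replicate_append_cons_self]

theorem reaches_erase_right (c : ℕ) (ks : List ℕ) (l r : List Improvement) :
    Reaches machine.step (onRight 9 l ((runs ◫ ks).reverse ++ (replicate c ◫ ++ r)))
      (onRight 9 (replicate c ▢ ++ (runs ▢ ks ++ l)) r) := by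
  have key : ∀ r, Reaches machine.step (onRight 9 l ((runs ◫ ks).reverse ++ r))
      (onRight 9 (runs ▢ ks ++ l) r) := by
    induction ks with
    | nil => intro r; exact .refl _
    | cons k ks ih =>
      intro r
      convert (ih (■ :: (replicate (k + 1) ◫ ++ r))).trans (reaches_erase_run k _ r) using 2
      all_goals simp
  exact (key _).trans (reaches_erase _ _ _)

/-- After a production has been copied, the program is restored, the first two letters of the word
are removed, and the search for the next production begins. -/
theorem reaches_restore (c : ℕ) (ks : List ℕ) (l r : List Improvement) :
    Reaches machine.step
      (onRight 8 (■ :: l) (◫ :: ((runs ◫ ks).reverse ++ (replicate (c + 1) ◫ ++ ■ :: ■ :: r))))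
      (onLeft 1 (replicate c ▢ ++ (runs ▢ ks ++ ▢ :: ■ :: l)) (▢ :: ▢ :: ▢ :: r)) := by
  refine .step (step_onRight_right δ_8_1 _ _) ((reaches_erase_right _ _ _ _).trans ?_)
  rw [replicate_succ, cons_append]
  -- The two Railroads and the last erased cell before them become the three blanks in front of the
  -- word; the other `c` blanks are left to the program.
  exact .step (step_onRight_right δ_9_b _ _) (.step (step_onRight_left δ_8_b _ _)
    (.step (step_onLeft_left δ_3_b _ _) (.step (step_onLeft_right δ_3_0 _ _)
    (.step (step_onRight_left δ_0_1 _ _) (.step (step_onLeft_left δ_1_1 _ _) (.refl _))))))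

/-! ## Simulation of tag systems -/

/-- The segments of the production of a letter. -/
def productionSegments : List ℕ → List (List ℕ × ℕ)
  | [] => []
  | i :: w => [([], i + 1), (w.map (· + 1), 0)]

/-- The final `0` is the single blank that ends a production. It and the run of the first letter are
the only odd runs, so that a production has exactly two segments, however many letters it has. -/
theorem flatMap_productionSegments (i : ℕ) (w : List ℕ) :
    (productionSegments (i :: w)).flatMap segmentRuns = copyRuns i w ++ [0] := by
  simp [productionSegments, segmentRuns, copyRuns, Function.comp_def, Nat.mul_add]

theorem length_flatMap_productionSegments {ps : List (List ℕ)} (h : ∀ w ∈ ps, w ≠ []) :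
    (ps.flatMap productionSegments).length = 2 * ps.length := by
  induction ps with
  | nil => rfl
  | cons w ps ih =>
    obtain _ | ⟨i, w⟩ := w
    · simp at h
    · rw [flatMap_cons, length_append, ih fun w hw => h w (by simp [hw])]
      simp [productionSegments]
      omega

/-- The segments of the program of a tag system. The first two lead to the first production, and
the first one has variable length. -/
def programSegments (ps : List (List ℕ)) (E : ℕ) : List (List ℕ × ℕ) :=
  ([], E) :: ([], 0) :: ps.flatMap productionSegments

/-- The configuration of the machine for a word `w` in the tag system with productions `ps`. -/
def tagConfig (ps : List (List ℕ)) (E : ℕ) (w : List ℕ) : Config (Fin 10) Improvement :=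
  onLeft 1 (runs ▢ ((programSegments ps E).flatMap segmentRuns) ++ [▢, ◫])
    (▢ :: ▢ :: ▢ :: openCode w)

/-- Here `ps` holds only the productions before the wanted one. Their segments and the two leading
ones number `2 * ps.length + 2`, one more than the Roads in letter `ps.length`. What follows, `l`,
is kept arbitrary: a production in `reaches_tagConfig`, the end marker in `reaches_halt`. -/
theorem reaches_find {ps : List (List ℕ)} (hps : ∀ w ∈ ps, w ≠ []) (E j : ℕ) (w : List ℕ)
    (l : List Improvement) :
    Reaches machine.step
      (onLeft 1 (runs ▢ ((programSegments ps E).flatMap segmentRuns) ++ l)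
        (▢ :: ▢ :: ▢ :: openCode (ps.length :: j :: w)))
      (onLeft 5 l ((runs ◫ ((programSegments ps E).flatMap segmentRuns)).reverse ++
        (replicate (2 * ps.length + 6) ◫ ++ (j :: w).flatMap letterCode))) := by
  obtain ⟨F, hF, h₁, h₂⟩ := exists_openCode_eq j w
  rw [openCode, letterCode, h₁, h₂, append_assoc]
  refine (reaches_search _ _ ?_ _ _).trans ?_
  · simp [programSegments, length_flatMap_productionSegments hps]
  have h := reaches_join (U := replicate (2 * ps.length + 3) ◫ ++
    runs ◫ ((programSegments ps E).flatMap segmentRuns)) (by simp) hF l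
  refine .trans ?_ (h.trans ?_)
  · convert! Reaches.refl _ using 2
  · convert! Reaches.refl _ using 2; simp [replicate_succ, replicate_append_cons_self]

/-- The machine simulates one step of the tag system. -/
theorem reaches_tagConfig {ps : List (List ℕ)} (i : ℕ) (v : List ℕ) (qs : List (List ℕ))
    (hps : ∀ w ∈ ps, w ≠ []) (E j : ℕ) (w : List ℕ) :
    Reaches₁ machine.step (tagConfig (ps ++ (i :: v) :: qs) E (ps.length :: j :: w))
      (tagConfig (ps ++ (i :: v) :: qs) (E + ps.length + j + 3) (w ++ i :: v)) := by
  have h₁ := reaches_find hps E j w (runs ▢ (copyRuns i v) ++ ▢ :: ■ ::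
    (runs ▢ ((qs.flatMap productionSegments).flatMap segmentRuns) ++ [▢, ◫]))
  have h₂ := reaches_copy i v (F := ((runs ◫ ((programSegments ps E).flatMap segmentRuns)).reverse ++
        (replicate (2 * ps.length + 6) ◫ ++ (j :: w).flatMap letterCode))) (by
    obtain ⟨F, hF, -, h₂⟩ := exists_openCode_eq j w
    rw [h₂]
    simpa using hF) (runs ▢ ((qs.flatMap productionSegments).flatMap segmentRuns) ++ [▢, ◫])
  have h₃ := reaches_restore (2 * (ps.length + j + 3)) ((programSegments ps E).flatMap segmentRuns
    ++ copyRuns i v) (runs ▢ ((qs.flatMap productionSegments).flatMap segmentRuns) ++ [▢, ◫])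
    (openCode (w ++ i :: v))
  have e (n : ℕ) : runs ▢ ((programSegments (ps ++ (i :: v) :: qs) n).flatMap segmentRuns) =
      runs ▢ ((programSegments ps n).flatMap segmentRuns) ++ (runs ▢ (copyRuns i v) ++ ▢ :: ■ ::
      runs ▢ ((qs.flatMap productionSegments).flatMap segmentRuns)) := by
    simp only [programSegments, flatMap_append, flatMap_cons, flatMap_productionSegments,
      runs_append]
    simp
  -- States 1 and 5 differ, so the search takes at least one step.
  have h₁' := (Relation.reflTransGen_iff_eq_or_transGen.1 h₁).resolve_left
    fun h => absurd (congrArg Config.state h) (by simp [onLeft])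
  have e₁ : tagConfig (ps ++ (i :: v) :: qs) E (ps.length :: j :: w) =
      onLeft 1 (runs ▢ ((programSegments ps E).flatMap segmentRuns) ++ (runs ▢ (copyRuns i v) ++
        ▢ :: ■ :: (runs ▢ ((qs.flatMap productionSegments).flatMap segmentRuns) ++ [▢, ◫])))
        (▢ :: ▢ :: ▢ :: openCode (ps.length :: j :: w)) := by
    rw [tagConfig, e]
    simp
  rw [e₁]
  refine Relation.TransGen.trans_left h₁' (h₂.trans (.trans ?_ (h₃.trans ?_)))
  · convert! Reaches.refl _ using 3
    have e' : 2 * (ps.length + j + 3) + 1 = 2 * ps.length + 6 + (2 * j + 1) := by ring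
    rw [openCode_append, e', replicate_add]
    simp only [letterCode, flatMap_cons, runs_append, reverse_append, append_assoc, cons_append,
      nil_append]
  · convert! Reaches.refl _ using 2
    -- The joined letters leave an even number of blanks, which merge with the first run of the
    -- program and keep its length odd.
    have e' : 2 * (E + ps.length + j + 3) + 1 = 2 * (ps.length + j + 3) + (2 * E + 1) := by ring
    rw [tagConfig, e]
    simp [programSegments, segmentRuns, e', replicate_add]

/-- When the machine finds the letter without production, it halts. -/
theorem reaches_halt {ps : List (List ℕ)} (hps : ∀ w ∈ ps, w ≠ []) (E j : ℕ) (w : List ℕ) :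
    ∃ F, Reaches machine.step (tagConfig ps E (ps.length :: j :: w)) (onLeft 6 [◫] F) ∧
      F.count ■ = ((programSegments ps 0).flatMap segmentRuns).length + 2 * (w.length + 1) := by
  -- At the end marker, state 5 fills the blank and state 6 stands on the Road, the halting entry of
  -- the table.
  refine ⟨_, (reaches_find hps E j w [▢, ◫]).trans (.step (step_onLeft_left δ_5_0 _ _) (.refl _)), ?_⟩
  have h (s : Improvement) (hs : s ≠ ■) (ks : List ℕ) : (runs s ks).count ■ = ks.length := by
    induction ks with
    | nil => rfl
    | cons k ks ih => simp [count_replicate, ih, hs]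
  have h' (w : List ℕ) : (w.flatMap letterCode).count ■ = 2 * w.length := by
    induction w with
    | nil => rfl
    | cons k ks ih => simp [letterCode, count_replicate, ih]; omega
  rw [count_cons, count_append, count_append, h', count_reverse, h _ (by simp)]
  simp [programSegments, segmentRuns, count_replicate]

end CivV

section

/-! ## Programs on two binary stacks -/

open StateTransition

/-- The instructions of a program that works on two binary stacks, which are given as numbers. A
move pushes a bit to one stack, pops a bit from the other one and branches on it. -/
inductive StackInstruction (Λ : Type)
  | right (a : Bool) (next : Bool → Λ)
  | left (a : Bool) (next : Bool → Λ)
  | goto (ℓ : Λ)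
  | halt (a : Bool)

/-- One step of a program on two stacks. -/
def stackStep {Λ : Type} (P : Λ → StackInstruction Λ) (c : Λ × ℕ × ℕ) : Option (Λ × ℕ × ℕ) :=
  match P c.1 with
  | .right a next => some (next c.2.2.bodd, Nat.bit a c.2.1, c.2.2.div2)
  | .left a next => some (next c.2.1.bodd, c.2.1.div2, Nat.bit a c.2.2)
  | .goto ℓ => some (ℓ, c.2.1, c.2.2)
  | .halt _ => none

/-! ## Tag systems -/

/-- One step of the tag system with productions `p` and halting letter `h`: the first two letters
of the word are removed, and the production of the first one is appended. -/
inductive TagStep {α : Type} (p : α → List α) (h : α) : List α → List α → Prop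
  | intro {a : α} (ha : a ≠ h) (b : α) (w : List α) : TagStep p h (a :: b :: w) (w ++ p a)

/-- The concatenation of `n` copies of the word `w`. -/
def repeatWord {α : Type} (n : ℕ) (w : List α) : List α := (List.replicate n w).flatten

section

variable {α : Type}

@[simp] theorem repeatWord_zero (w : List α) : repeatWord 0 w = [] := rfl

theorem repeatWord_succ (n : ℕ) (w : List α) : repeatWord (n + 1) w = w ++ repeatWord n w := rfl

theorem repeatWord_add (m n : ℕ) (w : List α) :
    repeatWord (m + n) w = repeatWord m w ++ repeatWord n w := by
  rw [repeatWord, List.replicate_add, List.flatten_append]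
  rfl

theorem repeatWord_two_mul (n : ℕ) (w : List α) : repeatWord (2 * n) w = repeatWord n (w ++ w) := by
  induction n with
  | zero => rfl
  | succ n ih => simp [Nat.mul_succ, repeatWord_succ, ih]

theorem repeatWord_singleton (n : ℕ) (a : α) : repeatWord n [a] = List.replicate n a := by
  induction n with
  | zero => rfl
  | succ n ih => simp [repeatWord_succ, ih, List.replicate_succ]

@[simp] theorem length_repeatWord (n : ℕ) (w : List α) :
    (repeatWord n w).length = n * w.length := by
  simp [repeatWord]

@[simp] theorem map_repeatWord {β : Type} (f : α → β) (n : ℕ) (w : List α) :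
    (repeatWord n w).map f = repeatWord n (w.map f) := by
  simp [repeatWord]

@[simp] theorem flatMap_repeatWord {β : Type} (f : α → List β) (n : ℕ) (w : List α) :
    (repeatWord n w).flatMap f = repeatWord n (w.flatMap f) := by
  induction n with
  | zero => rfl
  | succ n ih => simp [repeatWord_succ, ih]

theorem repeatWord_pair_append (n : ℕ) (a b : α) :
    repeatWord n [a, b] ++ [a] = a :: repeatWord n [b, a] := by
  induction n with
  | zero => rfl
  | succ n ih => simp [repeatWord_succ, ih]

open Relation

variable {p : α → List α} {h : α}

/-- Reachability in a tag system. -/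
abbrev TagReaches (p : α → List α) (h : α) : List α → List α → Prop := ReflTransGen (TagStep p h)

/-- Reachability in a tag system in at least one step. -/
abbrev TagReaches₁ (p : α → List α) (h : α) : List α → List α → Prop := TransGen (TagStep p h)

theorem tagReaches_repeatWord {a : α} (ha : a ≠ h) (b : α) (n : ℕ) (w : List α) :
    TagReaches p h (repeatWord n [a, b] ++ w) (w ++ repeatWord n (p a)) := by
  induction n generalizing w with
  | zero => simpa using ReflTransGen.refl
  | succ n ih =>
    rw [repeatWord_succ, List.append_assoc]
    refine .head (TagStep.intro ha b _) ?_
    simpa [repeatWord_succ] using ih (w ++ p a)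

theorem tagReaches_cons_repeatWord {a : α} (ha : a ≠ h) (b : α) {c : α} (hc : c ≠ h) (d : α)
    (n : ℕ) (w : List α) :
    TagReaches₁ p h (a :: b :: (repeatWord n [c, d] ++ w)) (w ++ p a ++ repeatWord n (p c)) := by
  refine .head' (TagStep.intro ha b _) ?_
  simpa using tagReaches_repeatWord hc d n (w ++ p a)

/-- The first letters of a block that is read with a shift by one. -/
theorem tagReaches_shift {a d : α} (ha : a ≠ h) (hd : d ≠ h) (c e : α) (n : ℕ) (w : List α) :
    TagReaches p h (a :: (repeatWord n [c, d] ++ e :: w)) (w ++ p a ++ repeatWord n (p d)) := by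
  induction n generalizing a w with
  | zero => simpa using ReflTransGen.single (TagStep.intro ha e w)
  | succ n ih =>
    rw [repeatWord_succ, List.append_assoc]
    refine .head (TagStep.intro ha c _) ?_
    simpa [repeatWord_succ] using ih hd (w ++ p a)

/-- The word for two numbers `u` and `v`: the letters `A` and `B` mark the beginnings of the numbers
and the letters `a` and `b` are their units. Every second letter is `x`. -/
def pairWord (x A a B b : α) (u v : ℕ) : List α :=
  A :: x :: (repeatWord u [a, x] ++ B :: x :: repeatWord v [b, x])

/-- If only the first block is processed, its image is appended behind the second block: the two
numbers change places. -/
theorem tagReaches_rotate {x A a B b A' a' : α} (hA : p A = [A', x]) (ha : p a = [a', x])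
    (hAh : A ≠ h) (hah : a ≠ h) (u v : ℕ) :
    TagReaches₁ p h (pairWord x A a B b u v) (pairWord x B b A' a' v u) := by
  simpa [hA, ha, pairWord] using
    tagReaches_cons_repeatWord (p := p) hAh x hah x u (B :: x :: repeatWord v [b, x])

theorem tagReaches_map {x A a B b : α} (hAh : A ≠ h) (hah : a ≠ h) (hBh : B ≠ h) (hbh : b ≠ h)
    (u v : ℕ) :
    TagReaches₁ p h (pairWord x A a B b u v)
      (p A ++ repeatWord u (p a) ++ p B ++ repeatWord v (p b)) := by
  refine (tagReaches_cons_repeatWord (p := p) hAh x hah x u (B :: x :: repeatWord v [b, x])).trans ?_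
  simpa using tagReaches_cons_repeatWord (p := p) hBh x hbh x v (p A ++ repeatWord u (p a))

/-- A bit is pushed to the first number and a bit is popped from the second one. -/
theorem tagReaches_pushPop {x A a B b C c S s : α} {D d T t A' a' B' b' : Bool → α} {i : Bool}
    (hA : p A = C :: x :: bif i then [c, x] else []) (ha : p a = [c, x, c, x])
    (hB : p B = [S]) (hb : p b = [s])
    (hC : p C = [D true, D false]) (hc : p c = [d true, d false])
    (hS : p S = [T true, T false]) (hs : p s = [t true, t false])
    (hDt : p (D true) = [A' true, x]) (hDf : p (D false) = [x, A' false, x])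
    (hd : ∀ j, p (d j) = [a' j, x]) (hT : ∀ j, p (T j) = [B' j, x]) (ht : ∀ j, p (t j) = [b' j, x])
    (hAh : A ≠ h) (hah : a ≠ h) (hBh : B ≠ h) (hbh : b ≠ h) (hCh : C ≠ h) (hch : c ≠ h)
    (hSh : S ≠ h) (hsh : s ≠ h) (hDh : ∀ j, D j ≠ h) (hdh : ∀ j, d j ≠ h) (hTh : ∀ j, T j ≠ h)
    (hth : ∀ j, t j ≠ h) (u v : ℕ) :
    TagReaches₁ p h (pairWord x A a B b u v)
      (pairWord x (A' v.bodd) (a' v.bodd) (B' v.bodd) (b' v.bodd) (Nat.bit i u) v.div2) := by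
  have h₁ : TagReaches₁ p h (pairWord x A a B b u v)
      (C :: x :: (repeatWord (Nat.bit i u) [c, x] ++ S :: List.replicate v s)) := by
    -- The letter `a` doubles the first number and `A` adds the bit `i`. The second block loses its
    -- fillers, so it has `v + 1` letters, and its parity decides the phase in which everything
    -- after it is read.
    convert tagReaches_map (p := p) hAh hah hBh hbh u v using 1
    rw [hA, ha, hB, hb, repeatWord_singleton, Nat.bit_val, Nat.add_comm, repeatWord_add,
      repeatWord_two_mul]
    cases i <;> simp [repeatWord_succ]
  refine h₁.trans_left ?_
  generalize Nat.bit i u = u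
  refine (tagReaches_cons_repeatWord hCh x hch x u (S :: List.replicate v s)).to_reflTransGen.trans ?_
  rw [hC, hc]
  obtain ⟨j, v, rfl⟩ : ∃ j w, v = Nat.bit j w := ⟨v.bodd, v.div2, (Nat.bit_bodd_div2 v).symm⟩
  rw [Nat.bodd_bit, Nat.div2_bit]
  have hr : repeatWord v [s, s] = List.replicate (2 * v) s := by
    rw [← repeatWord_singleton, repeatWord_two_mul]
    rfl
  cases j with
  | true =>
    have e : S :: List.replicate (Nat.bit true v) s = S :: s :: repeatWord v [s, s] := by
      rw [hr, Nat.bit_val]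
      rfl
    rw [e]
    -- For odd `v` the block has even length and the reading stays in phase: the `true` letters are
    -- read and the `false` letters are dropped.
    have h₂ := tagReaches_cons_repeatWord (p := p) hSh s hsh s v
      (D true :: D false :: repeatWord u [d true, d false])
    rw [hS, hs] at h₂
    have h₃ := tagReaches_cons_repeatWord (p := p) (hDh true) (D false) (hdh true) (d false) u
      (T true :: T false :: repeatWord v [t true, t false])
    have h₄ := tagReaches_cons_repeatWord (p := p) (hTh true) (T false) (hth true) (t false) v
      (A' true :: x :: repeatWord u [a' true, x])
    rw [hDt, hd] at h₃
    rw [hT, ht] at h₄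
    refine .trans ?_ (h₂.to_reflTransGen.trans (.trans ?_ (h₃.to_reflTransGen.trans
      (.trans ?_ (h₄.to_reflTransGen.trans ?_)))))
    all_goals convert! ReflTransGen.refl using 1; simp [pairWord]
  | false =>
    have e : S :: List.replicate (Nat.bit false v) s = S :: repeatWord v [s, s] := by
      rw [hr, Nat.bit_val]
      rfl
    rw [e]
    -- For even `v` the last letter of the block takes `D true` with it, and the `false` letters are
    -- read from then on. The extra `x` at the front of `p (D false)` is removed with the last
    -- letter of the second block and restores the phase.
    have h₂ := tagReaches_shift (p := p) hSh hsh s (D true) v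
      (D false :: repeatWord u [d true, d false])
    rw [hS, hs] at h₂
    have h₃ := tagReaches_shift (p := p) (hDh false) (hdh false) (d true) (T true) u
      (T false :: repeatWord v [t true, t false])
    have h₄ := tagReaches_shift (p := p) (hTh false) (hth false) (t true) x v
      (A' false :: x :: repeatWord u [a' false, x])
    rw [hDf, hd] at h₃
    rw [hT, ht] at h₄
    refine .trans ?_ (h₂.trans (.trans ?_ (h₃.trans (.trans ?_ (h₄.trans ?_)))))
    all_goals convert! ReflTransGen.refl using 1; simp [pairWord]

end

/-! ## The tag system of a program on two stacks -/

/-- The letters of the tag system of a program. In `num`, `aux`, `mid` and `out`, the first Boolean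
tells the second number from the first one, and the second Boolean tells the letter that marks the
beginning of a number from the unit. -/
inductive TagLetter (Λ : Type)
  | filler
  | unit
  | halt
  | num (side big : Bool) (ℓ : Λ)
  | aux (side big : Bool) (ℓ : Λ)
  | mid (side big : Bool) (ℓ : Λ)
  | out (side big bit : Bool) (ℓ : Λ)

namespace TagLetter

variable {Λ : Type}

instance [Finite Λ] : Finite (TagLetter Λ) := by
  let f : TagLetter Λ → Fin 7 × Bool × Bool × Bool × Option Λ
    | filler => (0, false, false, false, none)
    | unit => (1, false, false, false, none)
    | halt => (2, false, false, false, none)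
    | num s b ℓ => (3, s, b, false, some ℓ)
    | aux s b ℓ => (4, s, b, false, some ℓ)
    | mid s b ℓ => (5, s, b, false, some ℓ)
    | out s b i ℓ => (6, s, b, i, some ℓ)
  refine Finite.of_injective f fun a b h => ?_
  cases a <;> cases b <;> simp_all [f]

/-- The letters that double a number and push the bit `a` to it. -/
def push (a : Bool) (ℓ : Λ) : Bool → List (TagLetter Λ)
  | true => mid false true ℓ :: filler :: bif a then [mid false false ℓ, filler] else []
  | false => [mid false false ℓ, filler, mid false false ℓ, filler]

/-- The productions of the letters for numbers, by the instruction at the label `ℓ`. -/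
def numProduction (ℓ : Λ) : StackInstruction Λ → Bool → Bool → List (TagLetter Λ)
  | .right a _, false, big => push a ℓ big
  | .right _ _, true, big => [mid true big ℓ]
  | .left _ _, false, big => [aux false big ℓ, filler]
  | .left a _, true, big => push a ℓ big
  | .goto ℓ', side, big => [num side big ℓ', filler]
  | .halt a, false, true => halt :: filler :: bif a then [unit, filler] else []
  | .halt _, true, true => [unit, filler]
  | .halt _, _, false => [unit, filler, unit, filler]

/-- The letter that is produced at the end of an instruction. -/
def target : StackInstruction Λ → Bool → Bool → Bool → TagLetter Λ
  | .right _ next, side, big, i => num side big (next i)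
  | .left _ next, true, big, i => num false big (next i)
  | .left _ next, false, big, i => aux true big (next i)
  | _, _, _, _ => filler

/-- The productions of the tag system of a program. -/
def production (P : Λ → StackInstruction Λ) : TagLetter Λ → List (TagLetter Λ)
  | filler => [filler]
  | unit => [filler]
  | halt => [filler]
  | num side big ℓ => numProduction ℓ (P ℓ) side big
  | aux false big ℓ => [mid true big ℓ]
  | aux true big ℓ => [num true big ℓ, filler]
  | mid side big ℓ => [out side big true ℓ, out side big false ℓ]
  | out false true false ℓ => [filler, target (P ℓ) false true false, filler]
  | out side big i ℓ => [target (P ℓ) side big i, filler]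

/-- The search counts two segments per letter, and an empty production would contribute none. -/
theorem production_ne_nil (P : Λ → StackInstruction Λ) (a : TagLetter Λ) :
    production P a ≠ [] := by
  rcases a with _ | _ | _ | ⟨side, big, ℓ⟩ | ⟨_ | _, _, _⟩ | _ | ⟨_ | _, _ | _, _ | _, _⟩ <;>
    simp only [production, ne_eq, reduceCtorEq, not_false_eq_true]
  cases P ℓ <;> cases side <;> cases big <;> simp [numProduction, push]

/-- The word for a configuration of the program. -/
def word (c : Λ × ℕ × ℕ) : List (TagLetter Λ) :=
  pairWord filler (num false true c.1) (num false false c.1) (num true true c.1)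
    (num true false c.1) c.2.1 c.2.2

theorem tagReaches_map_num (P : Λ → StackInstruction Λ) {ℓ : Λ} (u v : ℕ) :
    TagReaches₁ (production P) halt (word (ℓ, u, v))
      (production P (num false true ℓ) ++ repeatWord u (production P (num false false ℓ)) ++
        production P (num true true ℓ) ++ repeatWord v (production P (num true false ℓ))) :=
  tagReaches_map (by simp) (by simp) (by simp) (by simp) u v

theorem tagReaches_word {P : Λ → StackInstruction Λ} {c c' : Λ × ℕ × ℕ} (h : stackStep P c = some c') :
    TagReaches₁ (production P) halt (word c) (word c') := by
  obtain ⟨ℓ, u, v⟩ := c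
  cases hP : P ℓ with
  | right a next =>
    simp only [stackStep, hP, Option.some.injEq] at h
    subst h
    refine tagReaches_pushPop (C := mid false true ℓ) (c := mid false false ℓ)
      (S := mid true true ℓ) (s := mid true false ℓ) (D := fun i => out false true i ℓ)
      (d := fun i => out false false i ℓ) (T := fun i => out true true i ℓ)
      (t := fun i => out true false i ℓ) (A' := fun i => num false true (next i))
      (a' := fun i => num false false (next i)) (B' := fun i => num true true (next i))
      (b' := fun i => num true false (next i)) (i := a)
      ?_ ?_ ?_ ?_ ?_ ?_ ?_ ?_ ?_ ?_ ?_ ?_ ?_ ?_ ?_ ?_ ?_ ?_ ?_ ?_ ?_ ?_ ?_ ?_ ?_ u v <;>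
      simp [production, numProduction, push, target, hP]
  | left a next =>
    simp only [stackStep, hP, Option.some.injEq] at h
    subst h
    refine (tagReaches_rotate (A' := aux false true ℓ) (a' := aux false false ℓ)
      ?_ ?_ ?_ ?_ u v).trans ((tagReaches_pushPop (C := mid false true ℓ) (c := mid false false ℓ)
      (S := mid true true ℓ) (s := mid true false ℓ) (D := fun i => out false true i ℓ)
      (d := fun i => out false false i ℓ) (T := fun i => out true true i ℓ)
      (t := fun i => out true false i ℓ) (A' := fun i => aux true true (next i))
      (a' := fun i => aux true false (next i)) (B' := fun i => num false true (next i))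
      (b' := fun i => num false false (next i)) (i := a)
      ?_ ?_ ?_ ?_ ?_ ?_ ?_ ?_ ?_ ?_ ?_ ?_ ?_ ?_ ?_ ?_ ?_ ?_ ?_ ?_ ?_ ?_ ?_ ?_ ?_ v u).trans
      (tagReaches_rotate ?_ ?_ ?_ ?_ _ _)) <;>
      simp [production, numProduction, push, target, hP]
  | goto ℓ' =>
    simp only [stackStep, hP, Option.some.injEq] at h
    subst h
    simpa [production, numProduction, pairWord, word, hP] using
      tagReaches_map_num P (ℓ := ℓ) u v
  | halt a => simp [stackStep, hP] at h

theorem tagReaches_halt {P : Λ → StackInstruction Λ} {ℓ : Λ} {a : Bool} (h : P ℓ = .halt a)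
    (u v : ℕ) :
    ∃ w, w.length = 2 * (2 * u + 2 * v + a.toNat) + 2 ∧
      TagReaches₁ (production P) halt (word (ℓ, u, v)) (halt :: filler :: w) := by
  refine ⟨(bif a then [unit, filler] else []) ++ (repeatWord u [unit, filler, unit, filler] ++
    unit :: filler :: repeatWord v [unit, filler, unit, filler]), ?_, ?_⟩
  · cases a <;> simp <;> ring
  · simpa [production, numProduction, h] using tagReaches_map_num P (ℓ := ℓ) u v

end TagLetter

end

/-! ## The machine simulates programs on two stacks -/

namespace CivV

open StateTransition TuringMachine TuringMachine.Config List Relation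

section

variable {α : Type} [DecidableEq α] {p : α → List α} {h : α} {letters : List α}

/-- The productions of a tag system, with the letters replaced by their numbers. -/
def numberedProductions (p : α → List α) (letters : List α) : List (List ℕ) :=
  letters.map fun a => (p a).map letters.idxOf

/-- The number of a letter is its position in `letters`, hence the number of productions that
precede its own. -/
theorem reaches₁_of_tagStep (hp : ∀ a, p a ≠ []) (hl : ∀ a, a ≠ h → a ∈ letters) {w w' : List α}
    (hw : TagStep p h w w') (E : ℕ) :
    ∃ E', Reaches₁ machine.step
      (tagConfig (numberedProductions p letters) E (w.map letters.idxOf))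
      (tagConfig (numberedProductions p letters) E' (w'.map letters.idxOf)) := by
  obtain @⟨a, ha, b, w⟩ := hw
  obtain ⟨as, bs, rfl, has⟩ := List.eq_append_cons_of_mem (hl a ha)
  have hidx : (as ++ a :: bs).idxOf a = as.length := by
    rw [idxOf_append_of_notMem has, idxOf_cons_self, add_zero]
  have key := fun i v => reaches_tagConfig
    (ps := as.map fun c => (p c).map (as ++ a :: bs).idxOf) i v
    (bs.map fun c => (p c).map (as ++ a :: bs).idxOf) (by simpa using fun c _ => hp c) E
    ((as ++ a :: bs).idxOf b) (w.map (as ++ a :: bs).idxOf)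
  obtain ⟨i, v, hiv⟩ := List.exists_cons_of_ne_nil (hp a)
  refine ⟨E + as.length + (as ++ a :: bs).idxOf b + 3, ?_⟩
  convert key ((as ++ a :: bs).idxOf i) (v.map (as ++ a :: bs).idxOf) using 2
  · simp [numberedProductions, hiv]
  · simp only [map_cons, hidx, length_map]
  · simp [numberedProductions, hiv]
  · simp
  · simp [hiv]

theorem reaches₁_of_tagReaches₁ (hp : ∀ a, p a ≠ []) (hl : ∀ a, a ≠ h → a ∈ letters)
    {w w' : List α} (hw : TagReaches₁ p h w w') (E : ℕ) :
    ∃ E', Reaches₁ machine.step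
      (tagConfig (numberedProductions p letters) E (w.map letters.idxOf))
      (tagConfig (numberedProductions p letters) E' (w'.map letters.idxOf)) := by
  induction hw with
  | single hw => exact reaches₁_of_tagStep hp hl hw E
  | tail _ hw ih =>
    obtain ⟨E₁, h₁⟩ := ih
    obtain ⟨E₂, h₂⟩ := reaches₁_of_tagStep hp hl hw E₁
    exact ⟨E₂, TransGen.trans h₁ h₂⟩

/-- For a missing letter `idxOf` returns the length of the list. So the halting letter is numbered
behind all productions, and the search for it reaches the end marker. -/
theorem exists_reaches_halt (hp : ∀ a, p a ≠ []) (hh : h ∉ letters) (E : ℕ) (b : α) (w : List α) :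
    ∃ F, Reaches machine.step
        (tagConfig (numberedProductions p letters) E ((h :: b :: w).map letters.idxOf))
        (onLeft 6 [.road] F) ∧
      F.count .railroad = ((programSegments (numberedProductions p letters) 0).flatMap
        segmentRuns).length + 2 * (w.length + 1) := by
  have key := reaches_halt (ps := numberedProductions p letters)
    (by simpa [numberedProductions] using fun c _ => hp c) E (letters.idxOf b)
    (w.map letters.idxOf)
  have hidx : letters.idxOf h = (numberedProductions p letters).length := by
    rw [List.idxOf_eq_length hh, numberedProductions, length_map]
  rw [map_cons, map_cons, hidx]
  simpa using key

end

/-- The machine simulates every program on two stacks that starts with an empty first stack. -/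
theorem exists_machine_simulation {Λ : Type} [Finite Λ] (P : Λ → StackInstruction Λ) (ℓ₀ : Λ) :
    ∃ (l c₁ c₂ c₃ : List Improvement) (k : ℕ), ∀ n,
      ((eval machine.step (onRight 0 l (c₁ ++ repeatWord n c₂ ++ c₃))).Dom ↔
        (eval (stackStep P) (ℓ₀, 0, n)).Dom) ∧
      ∀ ℓ u v a, (ℓ, u, v) ∈ eval (stackStep P) (ℓ₀, 0, n) → P ℓ = .halt a →
        ∃ F, onLeft 6 [.road] F ∈ eval machine.step (onRight 0 l (c₁ ++ repeatWord n c₂ ++ c₃)) ∧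
          F.count .railroad = k + 4 * (2 * u + 2 * v + a.toNat) := by
  classical
  have := Fintype.ofFinite (TagLetter Λ)
  let letters : List (TagLetter Λ) := (Finset.univ.erase .halt).toList
  have hl : ∀ a, a ≠ .halt → a ∈ letters := by simp [letters]
  have hh : .halt ∉ letters := by simp [letters]
  have hp := TagLetter.production_ne_nil P
  let ps := numberedProductions (TagLetter.production P) letters
  let R : Λ × ℕ × ℕ → Config (Fin 10) Improvement → Prop := fun c C =>
    ∃ E, C = tagConfig ps E ((TagLetter.word c).map letters.idxOf)
  let F : Λ × ℕ × ℕ → Config (Fin 10) Improvement → Prop := fun c C =>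
    ∀ a, P c.1 = .halt a → ∃ F, C = onLeft 6 [.road] F ∧
      F.count .railroad = (((programSegments ps 0).flatMap segmentRuns).length + 6) +
        4 * (2 * c.2.1 + 2 * c.2.2 + a.toNat)
  have hs : ∀ c C, R c C → ∀ c', stackStep P c = some c' →
      ∃ C', R c' C' ∧ Reaches₁ machine.step C C' := by
    rintro c _ ⟨E, rfl⟩ c' hc
    obtain ⟨E', h⟩ := reaches₁_of_tagReaches₁ hp hl (TagLetter.tagReaches_word hc) E
    exact ⟨_, ⟨E', rfl⟩, h⟩
  have hn : ∀ c C, R c C → stackStep P c = none →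
      ∃ C', Reaches machine.step C C' ∧ machine.step C' = none ∧ F c C' := by
    rintro ⟨ℓ, u, v⟩ _ ⟨E, rfl⟩ hc
    obtain ⟨a, ha⟩ : ∃ a, P ℓ = .halt a := by
      cases h : P ℓ <;> simp [stackStep, h] at hc ⊢
    obtain ⟨w, hw, h₁⟩ := TagLetter.tagReaches_halt ha u v
    obtain ⟨E', h₂⟩ := reaches₁_of_tagReaches₁ hp hl h₁ E
    obtain ⟨F, h₃, hF⟩ := exists_reaches_halt hp hh E' .filler w
    refine ⟨_, .trans h₂.to_reflTransGen h₃, ?_, fun b hb => ⟨F, rfl, ?_⟩⟩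
    · rw [onLeft_cons]
      rfl
    · obtain rfl : a = b := by simpa [ha] using hb
      rw [hF, hw]
      ring
  let l := runs .noImprovement ((programSegments ps 0).flatMap segmentRuns) ++
    [.noImprovement, .road]
  -- The leading Road is erased by state 0 in the first step, which sends the head to the left in
  -- state 1 and gives `tagConfig ps 0`.
  refine ⟨l, .road :: .noImprovement :: .noImprovement ::
    (([.num false true ℓ₀, .filler, .num true true ℓ₀] : List (TagLetter Λ)).map
      letters.idxOf).flatMap letterCode,
    (([.filler, .num true false ℓ₀] : List (TagLetter Λ)).map letters.idxOf).flatMap letterCode,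
    openCode [letters.idxOf .filler], ((programSegments ps 0).flatMap segmentRuns).length + 6,
    fun n => ?_⟩
  have hw : openCode ((TagLetter.word (ℓ₀, 0, n)).map letters.idxOf) =
      (([.num false true ℓ₀, .filler, .num true true ℓ₀] : List (TagLetter Λ)).map
      letters.idxOf).flatMap letterCode ++ repeatWord n
      ((([.filler, .num true false ℓ₀] : List (TagLetter Λ)).map letters.idxOf).flatMap letterCode)
      ++ openCode [letters.idxOf .filler] := by
    rw [← flatMap_repeatWord, ← flatMap_append, ← openCode_append, TagLetter.word, pairWord]
    -- The pairs are regrouped with the filler in front, so that the last filler of the word is the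
    -- open letter and all others have closed codes.
    simp [← repeatWord_pair_append]
  have h₀ : machine.step (onRight 0 l (.road :: .noImprovement :: .noImprovement ::
      openCode ((TagLetter.word (ℓ₀, 0, n)).map letters.idxOf))) =
      some (tagConfig ps 0 ((TagLetter.word (ℓ₀, 0, n)).map letters.idxOf)) :=
    step_onRight_left δ_0_1 _ _
  have hR : R (ℓ₀, 0, n) (tagConfig ps 0 ((TagLetter.word (ℓ₀, 0, n)).map letters.idxOf)) :=
    ⟨0, rfl⟩
  simp only [cons_append, ← hw]
  rw [reaches_eval (ReflTransGen.single h₀)]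
  refine ⟨⟨eval_dom_of_simulation hs hR, fun h => ?_⟩, fun ℓ u v a h ha => ?_⟩
  · obtain ⟨b, hb⟩ := Part.dom_iff_mem.1 h
    obtain ⟨d, hd, -⟩ := exists_mem_eval_of_simulation hs hn hR hb
    exact Part.dom_iff_mem.2 ⟨d, hd⟩
  · obtain ⟨d, hd, hF⟩ := exists_mem_eval_of_simulation hs hn hR h
    obtain ⟨G, rfl, hG⟩ := hF a ha
    exact ⟨G, hd, hG⟩

end CivV

section

/-! ## Post–Turing machines with two symbols -/

open StateTransition Turing

/-- The number whose binary digits, beginning with the lowest one, are given by `L`. -/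
def IsNumber (L : ListBlank Bool) (n : ℕ) : Prop := ∀ i, L.nth i = n.testBit i

namespace IsNumber

variable {L : ListBlank Bool} {m n : ℕ}

theorem eq (hm : IsNumber L m) (hn : IsNumber L n) : m = n :=
  Nat.eq_of_testBit_eq fun i => (hm i).symm.trans (hn i)

theorem empty : IsNumber ∅ 0 := fun i => by
  simp [show (∅ : ListBlank Bool) = ListBlank.mk [] from rfl, ListBlank.nth_mk]

theorem tail (h : IsNumber L n) : IsNumber L.tail n.div2 := fun i => by
  rw [← ListBlank.nth_succ, h, Nat.testBit_succ, Nat.div2_val]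

theorem head (h : IsNumber L n) : L.head = n.bodd := by
  rw [← ListBlank.nth_zero, h, Nat.testBit_zero, Nat.mod_two_of_bodd]
  cases n.bodd <;> rfl

theorem cons (h : IsNumber L n) (a : Bool) : IsNumber (L.cons a) (Nat.bit a n) := fun i => by
  cases i with
  | zero => simp
  | succ i => rw [ListBlank.nth_succ, ListBlank.tail_cons, h, Nat.testBit_bit_succ]

end IsNumber

/-- The number whose binary digits, beginning with the lowest one, are given by the list. -/
def bitsNumber (l : List Bool) : ℕ := l.foldr Nat.bit 0

theorem isNumber_bitsNumber (l : List Bool) : IsNumber (ListBlank.mk l) (bitsNumber l) := by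
  induction l with
  | nil => exact .empty
  | cons a l ih => exact ih.cons a

/-- The instruction for a statement of a machine with two symbols, by the symbol under the head and
the next state. -/
def stackInstruction {Λ : Type} (a : Bool) (q : Λ) :
    TM0.Stmt Bool → StackInstruction (Option (Λ × Bool))
  | .write b => .goto (some (q, b))
  | .move .left => .left a fun b => some (q, b)
  | .move .right => .right a fun b => some (q, b)

/-- The program on two stacks that simulates a machine with two symbols. The symbol under the head
is part of the label. At the label `none`, the first symbol is read. -/
def stackProgram {Λ : Type} [Inhabited Λ] (M : TM0.Machine Bool Λ) {S : Set Λ}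
    (hS : TM0.Supports M S) : Option (S × Bool) → StackInstruction (Option (S × Bool))
  -- The pushed `false` leaves the empty first stack at `0`.
  | none => .right false fun a => some (⟨default, hS.1⟩, a)
  | some (q, a) =>
    match h : M q a with
    | none => .halt a
    | some s => stackInstruction a ⟨s.1, hS.2 h q.2⟩ s.2

section

variable {Λ : Type} [Inhabited Λ] (M : TM0.Machine Bool Λ) {S : Set Λ} (hS : TM0.Supports M S)

/-- The configurations of the program that correspond to a configuration of the machine. -/
def StackRepresents (S : Set Λ) (C : TM0.Cfg Bool Λ) (c : Option (S × Bool) × ℕ × ℕ) : Prop :=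
  (∃ h : C.q ∈ S, c.1 = some (⟨C.q, h⟩, C.Tape.head)) ∧
    IsNumber C.Tape.left c.2.1 ∧ IsNumber C.Tape.right c.2.2

/-- The symbol under the head is in the label and on neither stack, so a move pushes it to one stack
and pops its successor from the other. -/
theorem exists_stackStep {C C' : TM0.Cfg Bool Λ} {c : Option (S × Bool) × ℕ × ℕ}
    (hc : StackRepresents S C c) (hC : TM0.step M C = some C') :
    ∃ c', StackRepresents S C' c' ∧ stackStep (stackProgram M hS) c = some c' := by
  obtain ⟨ℓ, u, v⟩ := c
  obtain ⟨q, T⟩ := C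
  obtain ⟨⟨hq, h₁⟩, h₂, h₃⟩ := hc
  dsimp only at hq h₁ h₂ h₃
  subst h₁
  obtain ⟨⟨q', s⟩, hM, rfl⟩ := Option.map_eq_some_iff.1 hC
  have hq' : q' ∈ S := hS.2 hM hq
  have hP : stackProgram M hS (some (⟨q, hq⟩, T.head)) = stackInstruction T.head ⟨q', hq'⟩ s := by
    simp only [stackProgram]
    split <;> rename_i hM'
    · cases hM.symm.trans hM'
    · cases hM.symm.trans hM'
      rfl
  simp only [stackStep, hP]
  obtain (_ | _) | b := s
  · refine ⟨_, ?_, rfl⟩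
    exact ⟨⟨hq', by simp [Tape.move, h₂.head]⟩, h₂.tail, h₃.cons _⟩
  · refine ⟨_, ?_, rfl⟩
    exact ⟨⟨hq', by simp [Tape.move, h₃.head]⟩, h₂.cons _, h₃.tail⟩
  · refine ⟨_, ?_, rfl⟩
    exact ⟨⟨hq', rfl⟩, h₂, h₃⟩

theorem stackProgram_eq_halt {C : TM0.Cfg Bool Λ} {c : Option (S × Bool) × ℕ × ℕ}
    (hc : StackRepresents S C c) (hC : TM0.step M C = none) :
    stackProgram M hS c.1 = .halt C.Tape.head := by
  obtain ⟨ℓ, u, v⟩ := c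
  obtain ⟨q, T⟩ := C
  obtain ⟨⟨hq, h₁⟩, -, -⟩ := hc
  dsimp only at hq h₁
  subst h₁
  have hM : M q T.head = none := by simpa [TM0.step] using hC
  simp only [stackProgram]
  split <;> rename_i hM'
  · rfl
  · cases hM.symm.trans hM'

/-- The program on two stacks simulates the machine. -/
theorem stackProgram_simulates {R : ListBlank Bool} {n : ℕ} (hR : IsNumber R n) :
    ((eval (stackStep (stackProgram M hS)) (none, 0, n)).Dom ↔
      (eval (TM0.step M) ⟨default, Tape.mk' ∅ R⟩).Dom) ∧
    ∀ C ∈ eval (TM0.step M) ⟨default, Tape.mk' ∅ R⟩, ∀ u m, IsNumber C.Tape.left u →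
      IsNumber C.Tape.right₀ m → ∃ ℓ v a,
        (ℓ, u, v) ∈ eval (stackStep (stackProgram M hS)) (none, 0, n) ∧
        stackProgram M hS ℓ = .halt a ∧ Nat.bit a v = m := by
  have hs : ∀ C c, StackRepresents S C c → ∀ C', TM0.step M C = some C' → ∃ c',
      StackRepresents S C' c' ∧ Reaches₁ (stackStep (stackProgram M hS)) c c' := fun C c h C' h' => by
    obtain ⟨c', h₁, h₂⟩ := exists_stackStep M hS h h'
    exact ⟨c', h₁, .single h₂⟩
  have hn : ∀ C c, StackRepresents S C c → TM0.step M C = none → ∃ c',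
      Reaches (stackStep (stackProgram M hS)) c c' ∧ stackStep (stackProgram M hS) c' = none ∧
      (StackRepresents S C c' ∧ stackProgram M hS c'.1 = .halt C.Tape.head) := fun C c h h' => by
    have := stackProgram_eq_halt M hS h h'
    exact ⟨c, .refl _, by simp [stackStep, this], h, this⟩
  have h₀ : stackStep (stackProgram M hS) (none, 0, n) =
      some (some (⟨default, hS.1⟩, n.bodd), 0, n.div2) := rfl
  have hR₀ : StackRepresents S ⟨default, Tape.mk' ∅ R⟩
      (some (⟨default, hS.1⟩, n.bodd), 0, n.div2) :=
    ⟨⟨hS.1, by simp [← hR.head]⟩, by simpa using IsNumber.empty, by simpa using hR.tail⟩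
  rw [reaches_eval (Relation.ReflTransGen.single h₀)]
  refine ⟨⟨fun h => eval_dom_of_simulation hs hR₀ h, fun h => ?_⟩, fun C hC u m hu hm => ?_⟩
  · obtain ⟨b, hb⟩ := Part.dom_iff_mem.1 h
    obtain ⟨d, hd, -⟩ := exists_mem_eval_of_simulation
      (F := fun C c' => StackRepresents S C c' ∧ _) hs hn hR₀ hb
    exact Part.dom_iff_mem.2 ⟨d, hd⟩
  · obtain ⟨⟨ℓ, u', v⟩, hd, ⟨-, h₁, h₂⟩, h₃⟩ := exists_mem_eval_of_simulation
      (F := fun C c' => StackRepresents S C c' ∧ _) hs hn hR₀ hC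
    obtain rfl := h₁.eq hu
    refine ⟨ℓ, v, _, hd, h₃, ?_⟩
    refine IsNumber.eq ?_ hm
    rw [Tape.right₀]
    exact h₂.cons _

end

/-! ## Partial recursive functions on two stacks -/

instance : Fintype PartrecToTM2.K' :=
  ⟨{.main, .rev, .aux, .stack}, fun k => by cases k <;> decide⟩

/-- Configurations with the same stacks have the same tape. -/
theorem TM2to1_tape_unique {K : Type} {Γ : K → Type} {Λ σ : Type} {q q' : Option Λ} {v v' : σ}
    {S : ∀ k, List (Γ k)} {c c' : TM1.Cfg (TM2to1.Γ' K Γ) (TM2to1.Λ' K Γ Λ σ) σ}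
    (h : TM2to1.TrCfg ⟨q, v, S⟩ c) (h' : TM2to1.TrCfg ⟨q', v', S⟩ c') : c.Tape = c'.Tape := by
  obtain ⟨L, hL⟩ := h
  obtain ⟨L', hL'⟩ := h'
  suffices L = L' by rw [this]
  refine ListBlank.ext fun i => funext fun k => ?_
  rw [TM2to1.stk_nth_val i (hL k), TM2to1.stk_nth_val i (hL' k)]

/-- For every code there are a finite program on two stacks and an encoding of lists of numbers by
lists of bits in blocks of constant length, such that the program computes the same function. -/
theorem exists_stackProgram_of_code (c : ToPartrec.Code) :
    ∃ (Λ : Type) (_ : Finite Λ) (P : Λ → StackInstruction Λ) (ℓ₀ : Λ) (n : ℕ)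
      (enc : TM2to1.Γ' PartrecToTM2.K' (fun _ => PartrecToTM2.Γ') → List.Vector Bool n),
      Function.Injective enc ∧ enc default = List.Vector.replicate n false ∧
      ∀ v : List ℕ, 
        let code (v : List ℕ) : ℕ := bitsNumber ((TM2to1.trInit PartrecToTM2.K'.main
          (PartrecToTM2.trList v)).flatMap fun a => (enc a).toList)
        ((eval (stackStep P) (ℓ₀, 0, code v)).Dom ↔ (c.eval v).Dom) ∧
        ∀ v' ∈ c.eval v, ∃ ℓ w a, (ℓ, 0, w) ∈ eval (stackStep P) (ℓ₀, 0, code v) ∧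
          P ℓ = .halt a ∧ Nat.bit a w = code v' := by
  classical
  let _ : Inhabited PartrecToTM2.Λ' := ⟨PartrecToTM2.trNormal c .halt⟩
  obtain ⟨n, enc, dec, enc0, encdec⟩ := TM1to1.exists_enc_dec
    (Γ := TM2to1.Γ' PartrecToTM2.K' (fun _ => PartrecToTM2.Γ'))
  let M₁ := TM2to1.tr PartrecToTM2.tr
  let M₁' := TM1to1.tr enc dec M₁
  let M₀ := TM1to0.tr M₁'
  -- The finite support of the compiled machine bounds the labels, so the program on two stacks is
  -- finite.
  have hS := TM1to0.tr_supports M₁' (TM1to1.tr_supports (enc := enc) dec M₁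
    (TM2to1.tr_supports PartrecToTM2.tr (PartrecToTM2.tr_supports c .halt)))
  refine ⟨_, inferInstance, stackProgram M₀ hS, none, n, enc,
    Function.LeftInverse.injective encdec, enc0, fun v => ?_⟩
  have hstk (v : List ℕ) : (TM2.init PartrecToTM2.K'.main (PartrecToTM2.trList v) :
      TM2.Cfg (fun _ => PartrecToTM2.Γ') PartrecToTM2.Λ' (Option PartrecToTM2.Γ')) =
      PartrecToTM2.init c v := by
    simp only [TM2.init, PartrecToTM2.init]
    congr
    funext k
    cases k <;> rfl
  have hinit (v : List ℕ) : TM2to1.TrCfg (PartrecToTM2.init c v)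
      (TM1.init (TM2to1.trInit PartrecToTM2.K'.main (PartrecToTM2.trList v))) := by
    rw [← hstk v]
    exact TM2to1.trCfg_init _ _
  let bits (v : List ℕ) : List Bool :=
    (TM2to1.trInit PartrecToTM2.K'.main (PartrecToTM2.trList v)).flatMap fun a => (enc a).toList
  have htape (v : List ℕ) : TM1to1.trTape enc0 (Tape.mk₁ (TM2to1.trInit PartrecToTM2.K'.main
      (PartrecToTM2.trList v))) = Tape.mk' ∅ (ListBlank.mk (bits v)) := by
    rw [Tape.mk₁, Tape.mk₂, TM1to1.trTape_mk', TM1to1.trTape', ListBlank.flatMap_mk,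
      ListBlank.flatMap_mk]
    rfl
  have hstart : TM1to0.trCfg M₁' (TM1to1.trCfg enc enc0 (TM1.init (TM2to1.trInit
      PartrecToTM2.K'.main (PartrecToTM2.trList v)))) =
      ⟨default, Tape.mk' ∅ (ListBlank.mk (bits v))⟩ := by
    rw [← htape]
    rfl
  have hsim := stackProgram_simulates M₀ hS (isNumber_bitsNumber (bits v))
  rw [← hstart] at hsim
  refine ⟨hsim.1.trans ?_, fun v' hv' => ?_⟩
  · rw [tr_eval_dom (TM1to0.tr_respects M₁') rfl,
      tr_eval_dom (TM1to1.tr_respects dec M₁ encdec) rfl,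
      tr_eval_dom (TM2to1.tr_respects PartrecToTM2.tr) (hinit v), PartrecToTM2.tr_eval]
    rfl
  · have h₂ : PartrecToTM2.halt v' ∈ eval (TM2.step PartrecToTM2.tr) (PartrecToTM2.init c v) := by
      rw [PartrecToTM2.tr_eval]
      exact Part.mem_map _ hv'
    obtain ⟨C₁, hC₁, h₁⟩ := StateTransition.tr_eval (TM2to1.tr_respects PartrecToTM2.tr) (hinit v) h₂
    obtain ⟨_, rfl, h₁'⟩ := StateTransition.tr_eval (TM1to1.tr_respects dec M₁ encdec) rfl h₁
    obtain ⟨_, rfl, h₀⟩ := StateTransition.tr_eval (TM1to0.tr_respects M₁') rfl h₁'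
    -- The stacks determine the tape, so the final tape is the initial tape for `v'`: outputs are
    -- coded exactly as inputs are.
    have hT : C₁.Tape = Tape.mk₁ (TM2to1.trInit PartrecToTM2.K'.main (PartrecToTM2.trList v')) :=
      TM2to1_tape_unique hC₁ (hinit v')
    have hT₀ : (TM1to0.trCfg M₁' (TM1to1.trCfg enc enc0 C₁)).Tape =
        Tape.mk' ∅ (ListBlank.mk (bits v')) := by
      rw [← htape, ← hT]
      rfl
    refine Exists.imp (fun ℓ => ?_) (hsim.2 _ h₀ 0 (bitsNumber (bits v')) ?_ ?_)
    · exact id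
    · rw [hT₀, Tape.mk'_left]
      exact .empty
    · rw [hT₀, Tape.mk'_right₀]
      exact isNumber_bitsNumber _

/-! ## The code of a number -/

theorem trPosNum_eq_map_bits (m : PosNum) :
    PartrecToTM2.trPosNum m = (Nat.bits m).map fun b => bif b then .bit1 else .bit0 := by
  induction m with
  | one => simp [PartrecToTM2.trPosNum]
  | bit1 m ih =>
    rw [PartrecToTM2.trPosNum, ih, PosNum.cast_bit1]
    simp [← two_mul]
  | bit0 m ih =>
    rw [PartrecToTM2.trPosNum, ih, PosNum.cast_bit0, ← two_mul, Nat.bit0_bits _ (PosNum.to_nat_pos m).ne']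
    rfl

theorem trNat_eq_map_bits (n : ℕ) :
    PartrecToTM2.trNat n = n.bits.map fun b => bif b then .bit1 else .bit0 := by
  have h := Num.to_of_nat n
  rw [PartrecToTM2.trNat]
  cases hn : (n : Num) with
  | zero =>
    rw [hn] at h
    obtain rfl : 0 = n := h
    simp [PartrecToTM2.trNum]
  | pos m =>
    rw [hn] at h
    rw [PartrecToTM2.trNum, trPosNum_eq_map_bits, ← h]
    rfl

/-- Course-of-values recursion: the bits of `n` are its parity followed by the bits of `n.div2`,
which is smaller. -/
theorem primrec_bits : Primrec Nat.bits := by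
  have h : Primrec₂ fun (_ : Unit) (n : ℕ) => n.bits := by
    refine Primrec.nat_strong_rec _ (g := fun _ l => if l.length = 0 then some [] else
      (l[l.length.div2]?).map fun t => l.length.bodd :: t) ?_ ?_
    · have hl : Primrec fun x : Unit × List (List Bool) => x.2.length :=
        Primrec.list_length.comp Primrec.snd
      refine Primrec.ite (Primrec.eq.comp hl (Primrec.const 0)) (Primrec.const _) ?_
      refine Primrec.option_map (Primrec.list_getElem?.comp Primrec.snd
        (Primrec.nat_div2.comp hl)) ?_
      exact Primrec.list_cons.comp (Primrec.nat_bodd.comp (hl.comp Primrec.fst)) Primrec.snd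
    · intro _ n
      obtain rfl | hn := Nat.eq_zero_or_pos n
      · simp
      · have : n.div2 < n := by rw [Nat.div2_val]; omega
        simp only [List.length_map, List.length_range, hn.ne', if_false, List.getElem?_map,
          List.getElem?_range this, Option.map_some, Option.some.injEq]
        conv_rhs => rw [← Nat.bit_bodd_div2 n]
        rw [Nat.bits_append_bit]
        intro h
        by_contra hb
        have := Nat.bit_bodd_div2 n
        rw [h] at this
        simp_all
  exact h.comp (Primrec.const ()) Primrec.id

/-! ### Blocks of bits as digits in base `2 ^ n` -/

theorem bitsNumber_append (l l' : List Bool) :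
    bitsNumber (l ++ l') = bitsNumber l + 2 ^ l.length * bitsNumber l' := by
  induction l with
  | nil => simp [bitsNumber]
  | cons a l ih =>
    have : ∀ l, bitsNumber (a :: l) = Nat.bit a (bitsNumber l) := fun _ => rfl
    rw [List.cons_append, this, this, ih, Nat.bit_val, Nat.bit_val, List.length_cons, pow_succ]
    ring

theorem bitsNumber_lt (l : List Bool) : bitsNumber l < 2 ^ l.length := by
  induction l with
  | nil => simp [bitsNumber]
  | cons a l ih =>
    have : bitsNumber (a :: l) = Nat.bit a (bitsNumber l) := rfl
    rw [this, Nat.bit_val, List.length_cons, pow_succ]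
    have := Bool.toNat_le a
    omega

theorem bitsNumber_inj {l l' : List Bool} (hl : l.length = l'.length)
    (h : bitsNumber l = bitsNumber l') : l = l' := by
  induction l generalizing l' with
  | nil => exact (List.length_eq_zero_iff.1 hl.symm).symm
  | cons a l ih =>
    obtain _ | ⟨a', l'⟩ := l'
    · simp at hl
    · have h' : Nat.bit a (bitsNumber l) = Nat.bit a' (bitsNumber l') := h
      have e₁ := congrArg Nat.bodd h'
      have e₂ := congrArg Nat.div2 h'
      rw [Nat.bodd_bit, Nat.bodd_bit] at e₁
      rw [Nat.div2_bit, Nat.div2_bit] at e₂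
      rw [e₁, ih (by simpa using hl) e₂]

theorem bitsNumber_replicate_false (n : ℕ) : bitsNumber (List.replicate n false) = 0 := by
  induction n with
  | zero => rfl
  | succ n ih =>
    have : bitsNumber (List.replicate (n + 1) false) =
      Nat.bit false (bitsNumber (List.replicate n false)) := rfl
    rw [this, ih]
    rfl

theorem bitsNumber_bits (n : ℕ) : bitsNumber n.bits = n := by
  induction n using Nat.binaryRec' with
  | zero => simp [bitsNumber]
  | bit b n h ih =>
    rw [Nat.bits_append_bit n b h]
    exact congrArg (Nat.bit b) ih

theorem bitsNumber_flatMap {α : Type} {n : ℕ} (enc : α → List.Vector Bool n) (l : List α) :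
    bitsNumber (l.flatMap fun a => (enc a).toList) =
      Nat.ofDigits (2 ^ n) (l.map fun a => bitsNumber (enc a).toList) := by
  induction l with
  | nil => rfl
  | cons a l ih =>
    rw [List.flatMap_cons, bitsNumber_append, ih, List.map_cons, Nat.ofDigits_cons,
      List.Vector.toList_length]

/-- Every partial recursive function is computed by a finite program on two stacks, in terms of a
primitive recursive code of numbers that is easy to decode. -/
theorem exists_stackProgram_of_partrec {f : ℕ →. ℕ} (hf : Partrec f) :
    ∃ (Λ : Type) (_ : Finite Λ) (P : Λ → StackInstruction Λ) (ℓ₀ : Λ) (g : ℕ → ℕ),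
      Primrec g ∧ Function.Injective g ∧ (∀ y, y ≤ g y) ∧
      ∀ x, ((eval (stackStep P) (ℓ₀, 0, g x)).Dom ↔ (f x).Dom) ∧
        ∀ y ∈ f x, ∃ ℓ u v a, (ℓ, u, v) ∈ eval (stackStep P) (ℓ₀, 0, g x) ∧
          P ℓ = .halt a ∧ 2 * u + 2 * v + a.toNat = g y := by
  obtain ⟨c, hc⟩ := ToPartrec.Code.exists_code (Nat.Partrec'.part_iff₁.2 hf)
  obtain ⟨Λ, hΛ, P, ℓ₀, n, enc, hinj, h0, h⟩ := exists_stackProgram_of_code c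
  let sym (b : Bool) (s : PartrecToTM2.Γ') : TM2to1.Γ' PartrecToTM2.K' (fun _ => PartrecToTM2.Γ') :=
    (b, Function.update (fun _ => none) PartrecToTM2.K'.main (some s))
  let bitSym (b : Bool) : TM2to1.Γ' PartrecToTM2.K' (fun _ => PartrecToTM2.Γ') :=
    sym false (bif b then .bit1 else .bit0)
  let d (b : Bool) : ℕ := bitsNumber (enc (bitSym b)).toList
  let d₀ : ℕ := bitsNumber (enc (sym true .cons)).toList
  let g (x : ℕ) : ℕ := d₀ + 2 ^ n * Nat.ofDigits (2 ^ n) (x.bits.reverse.map d)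
  have hg (x : ℕ) : bitsNumber ((TM2to1.trInit PartrecToTM2.K'.main
      (PartrecToTM2.trList [x])).flatMap fun a => (enc a).toList) = g x := by
    rw [bitsNumber_flatMap]
    -- The stack is written from its bottom: the separator comes first and carries the bottom mark
    -- `true`, and the bits follow with the highest one first.
    have : TM2to1.trInit PartrecToTM2.K'.main (PartrecToTM2.trList [x]) =
        sym true .cons :: x.bits.reverse.map bitSym := by
      have h : (PartrecToTM2.trList [x]).reverse =
          .cons :: x.bits.reverse.map fun b => bif b then .bit1 else .bit0 := by
        simp [PartrecToTM2.trList, trNat_eq_map_bits]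
      rw [TM2to1.trInit, h]
      exact congrArg (_ :: ·) (List.map_map ..)
    rw [this, List.map_cons, Nat.ofDigits_cons, List.map_map]
    rfl
  have hencinj {a b} (hab : bitsNumber (enc a).toList = bitsNumber (enc b).toList) : a = b :=
    hinj (List.Vector.toList_injective (bitsNumber_inj (by simp) hab))
  have hd : Function.Injective d := fun b b' hb => by
    have h₁ := congrFun (congrArg Prod.snd (hencinj hb)) PartrecToTM2.K'.main
    cases b <;> cases b' <;> simp [bitSym, sym] at h₁ ⊢
  have hd0 (b : Bool) : d b ≠ 0 := fun hb => by
    have h₁ : bitSym b = default := hencinj <| by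
      rw [h0, List.Vector.replicate]
      exact hb.trans (bitsNumber_replicate_false n).symm
    have h₁ := congrFun (congrArg Prod.snd h₁) PartrecToTM2.K'.main
    simp only [bitSym, sym, Function.update_self] at h₁
    exact Option.some_ne_none _ h₁
  have hdlt (b : Bool) : d b < 2 ^ n := by
    simpa using bitsNumber_lt (enc (bitSym b)).toList
  have hn : 1 < 2 ^ n := by have := hd0 true; have := hdlt true; omega
  -- The digits are below the base and nonzero, because only the blank column is coded by zeros. So
  -- the list of digits can be recovered, which gives injectivity and the lower bound on `g`.
  have hdig (l : List Bool) :
      Nat.digits (2 ^ n) (Nat.ofDigits (2 ^ n) (l.map d)) = l.map d := by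
    refine Nat.digits_ofDigits _ hn _ ?_ ?_
    · intro a ha
      obtain ⟨b, -, rfl⟩ := List.mem_map.1 ha
      exact hdlt b
    · intro hne
      obtain ⟨b, -, hb⟩ := List.mem_map.1 (List.getLast_mem hne)
      rw [← hb]
      exact hd0 b
  have hbits (x : ℕ) : x < 2 ^ x.bits.length := by
    rw [Nat.size_eq_bits_len]
    exact Nat.lt_size_self x
  refine ⟨Λ, hΛ, P, ℓ₀, g, ?_, ?_, ?_, ?_⟩
  · have : Primrec fun x : ℕ => x.bits.foldl (fun s b => d b + 2 ^ n * s) 0 := by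
      refine Primrec.list_foldl (h := fun _ p => d p.2 + 2 ^ n * p.1) primrec_bits
        (Primrec.const 0) ?_
      refine Primrec.nat_add.comp ((Primrec.dom_finite d).comp (Primrec.snd.comp Primrec.snd)) ?_
      exact Primrec.nat_mul.comp (Primrec.const _) (Primrec.fst.comp Primrec.snd)
    refine (Primrec.nat_add.comp (Primrec.const d₀)
      (Primrec.nat_mul.comp (Primrec.const (2 ^ n)) this)).of_eq fun x => ?_
    simp only [g]
    congr 2
    rw [Nat.ofDigits_eq_foldr]
    simp [List.foldl_map]
  · intro x y hxy
    have h₁ : Nat.ofDigits (2 ^ n) (x.bits.reverse.map d) =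
        Nat.ofDigits (2 ^ n) (y.bits.reverse.map d) := by
      have := Nat.add_left_cancel hxy
      exact Nat.eq_of_mul_eq_mul_left (by omega) this
    have h₂ := congrArg (Nat.digits (2 ^ n)) h₁
    rw [hdig, hdig] at h₂
    have h₃ := List.reverse_injective (List.map_injective_iff.2 hd h₂)
    rw [← bitsNumber_bits x, h₃, bitsNumber_bits]
  · intro y
    obtain rfl | hy := Nat.eq_zero_or_pos y
    · simp
    set V := Nat.ofDigits (2 ^ n) (y.bits.reverse.map d) with hV
    -- With `V` having as many digits as `y` has bits, `y < 2 ^ length ≤ (2 ^ n) ^ length ≤ 2 ^ n *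
    -- V`.
    have hlen : (Nat.digits (2 ^ n) V).length = y.bits.length := by rw [hV, hdig]; simp
    have hV0 : V ≠ 0 := fun h0 => by
      rw [h0, Nat.digits_zero, List.length_nil] at hlen
      have := hbits y
      rw [← hlen] at this
      omega
    have h₁ := Nat.base_pow_length_digits_le (2 ^ n) V hn hV0
    rw [hlen] at h₁
    have h₂ : 2 ^ y.bits.length ≤ (2 ^ n) ^ y.bits.length := Nat.pow_le_pow_left hn _
    have := hbits y
    change y ≤ d₀ + 2 ^ n * V
    omega
  · intro x
    obtain ⟨h₁, h₂⟩ := h [x]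
    simp only [hg] at h₁ h₂
    have hx : c.eval [x] = pure <$> f x := hc ⟨[x], rfl⟩
    rw [hx] at h₁ h₂
    refine ⟨h₁, fun y hy => ?_⟩
    obtain ⟨ℓ, w, a, h₃, h₄, h₅⟩ := h₂ [y] (Part.mem_map _ hy)
    refine ⟨ℓ, 0, w, a, h₃, h₄, ?_⟩
    rw [← hg, ← h₅, Nat.bit_val]
    ring

end

/-! ## Turing machines given by descriptions -/

namespace TuringMachine

open StateTransition

/-- The instructions of a machine, and a configuration of it by state and the two halves of its
tape. -/
abbrev DescribedConfig : Type := List (ℕ × ℕ × ℕ × Bool × ℕ) × ℕ × List ℕ × List ℕ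

/-- The start of the described machine on an input word. -/
def describedInit (x : Description × List ℕ) : DescribedConfig :=
  (x.1.2.2.2, x.1.2.2.1, [], x.2)

/-- The first instruction that applies to a state and a symbol. -/
def lookup (I : List (ℕ × ℕ × ℕ × Bool × ℕ)) (a : ℕ × ℕ) : Option (ℕ × ℕ × ℕ × Bool × ℕ) :=
  (I.filter fun i => (i.1, i.2.1) = a).head?

/-- One step of a described machine. -/
def describedStep (C : DescribedConfig) : Option DescribedConfig :=
  (lookup C.1 (C.2.1, C.2.2.2.headI)).map fun i =>
    (C.1, i.2.2.2.2, bif i.2.2.2.1 then (i.2.2.1 :: C.2.2.1, C.2.2.2.tail)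
      else (C.2.2.1.tail, C.2.2.1.headI :: i.2.2.1 :: C.2.2.2.tail))

theorem primrec_lookup : Primrec₂ lookup := by
  have h : PrimrecRel fun (i : ℕ × ℕ × ℕ × Bool × ℕ) (a : ℕ × ℕ) => (i.1, i.2.1) = a :=
    Primrec.eq.comp (Primrec.pair (Primrec.fst.comp Primrec.fst)
      (Primrec.fst.comp (Primrec.snd.comp Primrec.fst))) Primrec.snd
  exact Primrec.list_head?.comp h.listFilter

theorem primrec_describedInit : Primrec describedInit := by
  have h : Primrec fun x : Description × List ℕ => x.1.2.2 :=
    Primrec.snd.comp (Primrec.snd.comp Primrec.fst)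
  exact Primrec.pair (Primrec.snd.comp h)
    (Primrec.pair (Primrec.fst.comp h) (Primrec.pair (Primrec.const []) Primrec.snd))

theorem primrec_describedStep : Primrec describedStep := by
  have hq : Primrec fun C : DescribedConfig => C.2.1 := Primrec.fst.comp Primrec.snd
  have hl : Primrec fun C : DescribedConfig => C.2.2.1 :=
    Primrec.fst.comp (Primrec.snd.comp Primrec.snd)
  have hr : Primrec fun C : DescribedConfig => C.2.2.2 :=
    Primrec.snd.comp (Primrec.snd.comp Primrec.snd)
  refine Primrec.option_map
    (primrec_lookup.comp Primrec.fst (Primrec.pair hq (Primrec.list_headI.comp hr))) ?_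
  have hi : Primrec fun x : DescribedConfig × (ℕ × ℕ × ℕ × Bool × ℕ) => x.2.2.2 :=
    Primrec.snd.comp (Primrec.snd.comp Primrec.snd)
  have hs := Primrec.fst.comp hi
  have hd := Primrec.fst.comp (Primrec.snd.comp hi)
  have hl' := hl.comp (Primrec.fst (α := DescribedConfig) (β := ℕ × ℕ × ℕ × Bool × ℕ))
  have hr' := Primrec.list_tail.comp
    (hr.comp (Primrec.fst (α := DescribedConfig) (β := ℕ × ℕ × ℕ × Bool × ℕ)))
  refine Primrec.pair (Primrec.fst.comp Primrec.fst) (Primrec.pair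
    (Primrec.snd.comp (Primrec.snd.comp hi)) (Primrec.cond hd
      (Primrec.pair (Primrec.list_cons.comp hs hl') hr') (Primrec.pair
        (Primrec.list_tail.comp hl') (Primrec.list_cons.comp (Primrec.list_headI.comp hl')
          (Primrec.list_cons.comp hs hr')))))

/-- Evaluation is the unbounded iteration `PFun.fix` of a primitive recursive body. -/
theorem _root_.StateTransition.partrec_eval {σ : Type} [Primcodable σ] {f : σ → Option σ}
    (hf : Primrec f) : Partrec (eval f) := by
  refine Partrec.fix (Computable.partrec (Primrec.to_comp ?_))
  refine (Primrec.option_casesOn hf (Primrec.sumInl) (Primrec.sumInr.comp Primrec.snd).to₂).of_eq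
    fun a => ?_
  cases f a <;> rfl

variable {n k : ℕ} (M : TuringMachine (Fin (n + 1)) (Fin (k + 1)))

/-- A description has at most one instruction for each state and symbol, so the first match is the
only one. -/
theorem lookup_description (q : Fin (n + 1)) (s : Fin (k + 1)) :
    lookup M.description.2.2.2 (q, s) =
      (M.δ q s).map fun a => (q.val, s.val, a.2.1.val, isRight a.2.2, a.1.val) := by
  have hmem (i : ℕ × ℕ × ℕ × Bool × ℕ) : i ∈ M.description.2.2.2 ↔
      ∃ q s a, M.δ q s = some a ∧ (q.val, s.val, a.2.1.val, isRight a.2.2, a.1.val) = i := by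
    simp [description]
  rw [lookup, List.head?_filter]
  have huniq : ∀ i ∈ M.description.2.2.2, (i.1, i.2.1) = (q.val, s.val) →
      (M.δ q s).map (fun a => (q.val, s.val, a.2.1.val, isRight a.2.2, a.1.val)) = some i := by
    intro i hi h
    obtain ⟨q', s', a, ha, rfl⟩ := (hmem i).1 hi
    obtain ⟨h₁, h₂⟩ := Prod.mk.inj h
    obtain rfl := Fin.ext h₁
    obtain rfl := Fin.ext h₂
    rw [ha]
    rfl
  cases h : M.description.2.2.2.find? fun i => decide ((i.1, i.2.1) = (q.val, s.val)) with
  | some i =>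
    exact (huniq i (List.mem_of_find?_eq_some h) (by simpa using List.find?_some h)).symm
  | none =>
    cases ha : M.δ q s with
    | none => rfl
    | some a =>
      have := List.find?_eq_none.1 h _ ((hmem _).2 ⟨q, s, a, ha, rfl⟩)
      simp at this

/-- The described configurations that show a configuration of `M`. -/
def Describes (C : Config (Fin (n + 1)) (Fin (k + 1))) (D : DescribedConfig) : Prop :=
  ∃ l r : List (Fin (k + 1)), C.tape = Turing.Tape.mk₂ l r ∧
    D = (M.description.2.2.2, C.state.val, l.map Fin.val, r.map Fin.val)

theorem headI_map_val (l : List (Fin (k + 1))) : (l.map Fin.val).headI = l.headI.val := by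
  cases l <;> rfl

theorem describedStep_of_describes {C : Config (Fin (n + 1)) (Fin (k + 1))} {D : DescribedConfig}
    (h : M.Describes C D) : (M.step C = none → describedStep D = none) ∧
      ∀ C', M.step C = some C' → ∃ D', M.Describes C' D' ∧ describedStep D = some D' := by
  obtain ⟨q, T⟩ := C
  obtain ⟨l, r, rfl, rfl⟩ := h
  have hhead : (Turing.Tape.mk₂ l r).head = r.headI := by simp [Turing.Tape.mk₂, Turing.Tape.mk']
  simp only [step, describedStep, headI_map_val, lookup_description, hhead]
  cases M.δ q r.headI with
  | none => simp
  | some a =>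
    refine ⟨by simp, ?_⟩
    simp only [Option.map_some, Option.some.injEq, forall_eq']
    obtain ⟨q', s, _ | _⟩ := a
    · refine ⟨_, ⟨l.tail, l.headI :: s :: r.tail, ?_, rfl⟩, ?_⟩
      · simp [Turing.Tape.mk₂, Turing.Tape.mk', Turing.Tape.write, Turing.Tape.move]
      · simp [isRight, List.map_tail]
    · refine ⟨_, ⟨s :: l, r.tail, ?_, rfl⟩, ?_⟩
      · simp [Turing.Tape.mk₂, Turing.Tape.mk', Turing.Tape.write, Turing.Tape.move]
      · simp [isRight, List.map_tail]

theorem describes_init (w : List (Fin (k + 1))) :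
    M.Describes (M.init [] w) (describedInit (M.description, w.map Fin.val)) :=
  ⟨[], w, rfl, rfl⟩

theorem exists_mem_eval_describedStep {w : List (Fin (k + 1))}
    {C : Config (Fin (n + 1)) (Fin (k + 1))} (h : C ∈ M.run (M.init [] w)) :
    ∃ D ∈ eval describedStep (describedInit (M.description, w.map Fin.val)), M.Describes C D := by
  refine exists_mem_eval_of_simulation (R := M.Describes) (fun a c hR a' ha => ?_)
    (fun a c hR ha => ?_) (M.describes_init w) h
  · obtain ⟨D', h₁, h₂⟩ := (M.describedStep_of_describes hR).2 a' ha
    exact ⟨D', h₁, .single h₂⟩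
  · exact ⟨c, .refl _, (M.describedStep_of_describes hR).1 ha, hR⟩

theorem eval_describedStep_dom_iff (w : List (Fin (k + 1))) :
    (eval describedStep (describedInit (M.description, w.map Fin.val))).Dom ↔
      (M.run (M.init [] w)).Dom := by
  refine ⟨fun h => ?_, fun h => ?_⟩
  · refine eval_dom_of_simulation (R := M.Describes) (fun a c hR a' ha => ?_)
      (M.describes_init w) h
    obtain ⟨D', h₁, h₂⟩ := (M.describedStep_of_describes hR).2 a' ha
    exact ⟨D', h₁, .single h₂⟩
  · obtain ⟨C, hC⟩ := Part.dom_iff_mem.1 h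
    obtain ⟨D, hD, -⟩ := M.exists_mem_eval_describedStep hC
    exact Part.dom_iff_mem.2 ⟨D, hD⟩

end TuringMachine

section

/-! ## Universality -/

open StateTransition

/-- Two lists for the same half tape differ only by blanks at the end. Hence a count of a nonblank
symbol may serve as output, whichever lists present the final tape. -/
theorem Turing.ListBlank.count_eq_of_mk_eq {Γ : Type*} [Inhabited Γ] [DecidableEq Γ] {s : Γ}
    (hs : s ≠ default) {l l' : List Γ} (h : ListBlank.mk l = ListBlank.mk l') :
    l.count s = l'.count s := by
  have key (l l' : List Γ) (h : BlankExtends l l') : l.count s = l'.count s := by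
    obtain ⟨n, rfl⟩ := h
    simp [List.count_replicate, hs.symm]
  obtain h | h := Quotient.exact h
  · exact key _ _ h
  · exact (key _ _ h).symm

theorem Turing.Tape.count_eq_of_mk₂_eq {Γ : Type*} [Inhabited Γ] [DecidableEq Γ] {s : Γ}
    (hs : s ≠ default) {l r l' r' : List Γ} (h : Tape.mk₂ l r = Tape.mk₂ l' r') :
    l.count s + r.count s = l'.count s + r'.count s := by
  have h₁ := congrArg Tape.left h
  have h₂ := congrArg Tape.right₀ h
  simp only [Tape.mk₂, Tape.mk'_left, Tape.mk'_right₀] at h₁ h₂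
  rw [ListBlank.count_eq_of_mk_eq hs h₁, ListBlank.count_eq_of_mk_eq hs h₂]

theorem primrec_repeatWord {α : Type} [Primcodable α] (c : List α) :
    Primrec fun n => repeatWord n c := by
  refine (Primrec.nat_rec₁ (f := fun _ l => c ++ l) []
    (Primrec.list_append.comp (Primrec.const c) Primrec.snd)).of_eq fun n => ?_
  induction n with
  | zero => rfl
  | succ n ih => rw [repeatWord_succ, ← ih]

theorem primrec_count {α : Type} [Primcodable α] [DecidableEq α] (a : α) :
    Primrec fun l : List α => l.count a := by
  have h : PrimrecPred fun b : α => b = a := Primrec.eq.comp Primrec.id (Primrec.const a)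
  refine (Primrec.list_length.comp (Primrec.listFilter h)).of_eq fun l => ?_
  rw [List.count_eq_length_filter]
  congr 1

/-- A left inverse of a strictly expanding function, by bounded search. -/
theorem exists_primrec_leftInverse {g : ℕ → ℕ} (hg : Primrec g) (hinj : Function.Injective g)
    (hle : ∀ y, y ≤ g y) : ∃ g' : ℕ → ℕ, Primrec g' ∧ ∀ y, g' (g y) = y := by
  refine ⟨fun m => Nat.findGreatest (fun y => g y = m) m, ?_, fun y => ?_⟩
  · exact Primrec.nat_findGreatest Primrec.id
      (Primrec.eq.comp (hg.comp Primrec.snd) Primrec.fst)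
  · exact hinj (Nat.findGreatest_spec (P := fun z => g z = g y) (hle y) rfl)

-- All unbounded work is in `f`, which interprets descriptions and returns state and tape of the
-- halting configuration as one number. The decoding only counts Railroads, undoes `m ↦ k + 4 * m`,
-- and inverts `g`.
open TuringMachine Encodable in
theorem CivV.machine_isUniversal : machine.IsUniversal := by
  let f (n : ℕ) : Part ℕ :=
    (eval describedStep (describedInit ((decode n).getD default))).map fun C => encode C.2
  have hf : Partrec f := by
    refine Partrec.map ((partrec_eval primrec_describedStep).comp (Primrec.to_comp ?_))
      (Primrec.to_comp (Primrec.encode.comp (Primrec.snd.comp Primrec.snd)))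
    exact primrec_describedInit.comp (Primrec.option_getD.comp Primrec.decode (Primrec.const _))
  obtain ⟨Λ, _, P, ℓ₀, g, hg, hinj, hle, hP⟩ := exists_stackProgram_of_partrec hf
  obtain ⟨g', hg', hgg⟩ := exists_primrec_leftInverse hg hinj hle
  obtain ⟨l, c₁, c₂, c₃, k, hU⟩ := exists_machine_simulation P ℓ₀
  let number (x : Description × List Improvement × List Improvement) : ℕ :=
    (x.2.1.count .railroad + x.2.2.count .railroad - k) / 4
  have hnumber : Primrec number := by
    have h₁ := (primrec_count Improvement.railroad).comp
      (Primrec.fst.comp (Primrec.snd (α := Description)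
        (β := List Improvement × List Improvement)))
    have h₂ := (primrec_count Improvement.railroad).comp
      (Primrec.snd.comp (Primrec.snd (α := Description)
        (β := List Improvement × List Improvement)))
    exact Primrec.nat_div.comp (Primrec.nat_sub.comp (Primrec.nat_add.comp h₁ h₂)
      (Primrec.const k)) (Primrec.const 4)
  have hdecode : Primrec fun n => (decode n : Option (ℕ × List ℕ × List ℕ)).getD default :=
    Primrec.option_getD.comp Primrec.decode (Primrec.const _)
  refine ⟨fun x => (l, c₁ ++ repeatWord (g (encode x)) c₂ ++ c₃), fun x =>
    (decode (g' (number x)) : Option (ℕ × List ℕ × List ℕ)).getD default, ?_,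
    hdecode.comp (hg'.comp hnumber), ?_⟩
  · exact Primrec.pair (Primrec.const l) (Primrec.list_append.comp (Primrec.list_append.comp
      (Primrec.const c₁) ((primrec_repeatWord c₂).comp (hg.comp Primrec.encode)))
      (Primrec.const c₃))
  · intro n k' M w
    set x : Description × List ℕ := (M.description, w.map Fin.val) with hx
    have hfx : f (encode x) = (eval describedStep (describedInit x)).map fun C => encode C.2 := by
      simp only [f, encodek, Option.getD_some]
    refine ⟨?_, fun D hD E hE l₁ r₁ hE' => ?_⟩
    · refine ((hU (g (encode x))).1.trans (hP (encode x)).1).trans ?_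
      rw [hfx]
      exact M.eval_describedStep_dom_iff w
    · obtain ⟨C, hC, l', r', hD', rfl⟩ := M.exists_mem_eval_describedStep hD
      refine ⟨l', r', hD', ?_⟩
      obtain ⟨ℓ, u, v, a, h₁, h₂, h₃⟩ := (hP (encode x)).2 _ (by rw [hfx]; exact Part.mem_map _ hC)
      obtain ⟨F, hF, hk⟩ := (hU (g (encode x))).2 ℓ u v a h₁ h₂
      cases Part.mem_unique hE hF
      rw [onLeft_cons] at hE'
      have hcount := Turing.Tape.count_eq_of_mk₂_eq (s := Improvement.railroad) (by decide) hE'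
      have : number (M.description, l₁, r₁) =
          g (encode (D.state.val, l'.map Fin.val, r'.map Fin.val)) := by
        rw [← h₃]
        simp only [number, ← hcount, List.count_nil, List.count_cons, hk]
        simp
      simp only [this, hgg, encodek, Option.getD_some]

end

/-! ## The machine in the game -/

namespace CivV

/-! ### Turns of single Workers -/

section Play

variable {G : GameMap} {S : Session}

theorem Play.trans {m n : ℕ} {P P' P'' : Position} (h : Play G S m P P') (h' : Play G S n P' P'') :
    Play G S (m + n) P P'' := by
  induction h with
  | nil P => simpa using h'
  | cons hT _ ih =>
    rw [Nat.add_right_comm]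
    exact .cons hT (ih h')

/-- A turn in which one Worker acts and the other waits. -/
theorem Play.of_legal {P : Position} {w : Worker} {o : Order} (h : Legal G S P w o) :
    Play G S 1 P (act S P w o) := by
  refine .cons (P' := act S P w o) ?_ (.nil _)
  cases w with
  | tape => exact ⟨o, .wait, h, trivial, rfl⟩
  | state => exact ⟨.wait, o, trivial, h, rfl⟩

theorem Legal.congr {P P' : Position} {w : Worker} {i : Improvement}
    (hi : P'.improvement = P.improvement) (hw : P'.worker = P.worker)
    (h : Legal G S P w (.build i)) : Legal G S P' w (.build i) := by
  cases i with
  | noImprovement => exact h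
  | road => simpa only [Legal, hi, hw] using h
  | railroad => simpa only [Legal, hi, hw] using h

/-- A Worker finishes an improvement. -/
theorem Play.build {w : Worker} {i : Improvement} (d : ℕ) {P : Position}
    (h : Legal G S P w (.build i)) (hd : P.progress (P.worker w) i + (d + 1) = S.turns i)
    (h0 : ∀ t ≠ P.worker w, P.progress t = 0) :
    Play G S (d + 1) P
      ⟨Function.update P.improvement (P.worker w) i, 0, P.worker⟩ := by
  induction d generalizing P with
  | zero =>
    have h' := Play.of_legal h
    have : Function.update P.progress (P.worker w) 0 = 0 := by
      funext t
      by_cases ht : t = P.worker w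
      · subst ht; simp
      · simp [ht, h0 t ht]
    rwa [act, if_neg (by omega), this] at h'
  | succ d ih =>
    have h' := Play.of_legal h
    rw [act, if_pos (by omega)] at h'
    rw [Nat.add_comm]
    refine h'.trans (ih (P := ⟨P.improvement, _, P.worker⟩) (Legal.congr rfl rfl h) ?_ ?_)
    · simp only [and_self, if_true]
      omega
    · intro t ht
      funext j
      simp only at ht
      simp [ht, h0 t ht]

theorem Session.exists_turns_eq (S : Session) {i : Improvement} (hi : i ≠ .noImprovement) :
    ∃ d, S.turns i = d + 1 ∧ d + 1 ≤ max S.roadTurns S.railroadTurns := by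
  have h₁ := S.roadTurns_pos
  have h₂ := S.railroadTurns_pos
  cases i with
  | noImprovement => exact (hi rfl).elim
  | road => exact ⟨S.roadTurns - 1, by simp only [turns]; omega, by omega⟩
  | railroad => exact ⟨S.railroadTurns - 1, by simp only [turns]; omega, by omega⟩

theorem Play.exists_build {P : Position} {w : Worker} {i : Improvement}
    (h : Legal G S P w (.build i)) (h0 : P.progress = 0) :
    ∃ n ≤ max S.roadTurns S.railroadTurns, Play G S n P
      ⟨Function.update P.improvement (P.worker w) i, 0, P.worker⟩ := by
  have hi : i ≠ .noImprovement := by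
    rintro rfl
    exact h
  obtain ⟨d, hd, hle⟩ := S.exists_turns_eq hi
  exact ⟨d + 1, hle, Play.build d h (by simp [h0, hd]) (by simp [h0])⟩

theorem Play.remove {P : Position} {w : Worker} (h : P.improvement (P.worker w) ≠ .noImprovement)
    (h0 : P.progress = 0) : Play G S 1 P
      ⟨Function.update P.improvement (P.worker w) .noImprovement, 0, P.worker⟩ := by
  have := Play.of_legal (G := G) (S := S) (P := P) (w := w) (o := .remove) h
  rwa [act, h0] at this

end Play

/-- This makes the tape orders possible under the rules, guarantees that the reserved tiles suffice
for each change of state, and supplies the constants 3 and 5 in the bound on turns. -/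
theorem commandTable_spec (q : Fin 10) (s : Improvement) (c : Command)
    (h : commandTable q s = some c) :
    (c.tape = .buildRoad → s ≠ .road) ∧ (c.tape = .buildRailroad → s ≠ .railroad) ∧
      (c.tape = .remove → s ≠ .noImprovement) ∧ -5 ≤ c.change ∧ c.change ≤ 3 ∧
      0 ≤ q.val + c.change ∧ q.val + c.change ≤ 9 := by
  fin_cases q <;> cases s <;> simp [commandTable] at h <;> subst h <;> simp

/-! ### Configurations and commands on the map -/

namespace Layout

variable {G : GameMap} (L : Layout G) {S : Session}

theorem strip_notMem_reserved (i : ℤ) : L.strip i ∉ L.reserved :=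
  fun h => L.strip_notMem_area i (L.reserved_subset h)

theorem railroads_congr {P P' : Position}
    (h : ∀ t ∈ L.reserved, P'.improvement t = P.improvement t) : L.railroads P' = L.railroads P := by
  rw [railroads, railroads]
  congr 1
  exact Finset.filter_congr fun t ht => by rw [h t ht]

/-- The strip is injective and avoids the reserved tiles, so tape and state can be laid out
independently. -/
theorem exists_represents (C : TuringMachine.Config (Fin 10) Improvement) :
    ∃ P, L.Represents C P := by
  obtain ⟨s, hs, hcard⟩ := Finset.exists_subset_card_eq (s := L.reserved) (n := C.state.val)
    (by rw [L.reserved_card]; omega)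
  obtain ⟨t, ht⟩ := Finset.card_pos.1 (by rw [L.reserved_card]; omega : 0 < L.reserved.card)
  refine ⟨⟨Function.extend L.strip C.tape.nth fun t => if t ∈ s then .railroad else .noImprovement,
    0, fun | .tape => L.strip 0 | .state => t⟩, ?_, ⟨0, rfl, fun i => ?_⟩, ht, rfl⟩
  · rw [← hcard, railroads]
    congr 1
    ext t
    simp only [Finset.mem_filter]
    have key (ht : t ∈ L.reserved) : ¬∃ i, L.strip i = t := by
      rintro ⟨i, rfl⟩
      exact L.strip_notMem_reserved i ht
    constructor
    · rintro ⟨ht, h⟩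
      rw [Function.extend_apply' _ _ _ (key ht)] at h
      by_contra hs
      simp [hs] at h
    · intro h
      exact ⟨hs h, by rw [Function.extend_apply' _ _ _ (key (hs h)), if_pos h]⟩
  · simp only [zero_add]
    exact L.strip_injective.extend_apply ..

variable {L} in
theorem Represents.command_eq {C : TuringMachine.Config (Fin 10) Improvement} {P : Position}
    (h : L.Represents C P) : L.command P = commandTable C.state C.tape.head := by
  obtain ⟨h₁, ⟨p, hp, h₂⟩, -, -⟩ := h
  have h₃ := h₂ 0
  rw [add_zero, ← hp, Turing.Tape.nth_zero] at h₃
  rw [command, h₃]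
  congr 1
  exact Fin.ext h₁

variable {L} in
theorem Represents.of_carriesOut {C : TuringMachine.Config (Fin 10) Improvement} {P P' : Position}
    (h : L.Represents C P) {c : Command} (hc : L.command P = some c) (h' : L.CarriesOut c P P') :
    ∃ C', machine.step C = some C' ∧ L.Represents C' P' := by
  rw [h.command_eq] at hc
  obtain ⟨h₁, ⟨p, hp, h₂⟩, -, -⟩ := h
  obtain ⟨⟨p', hp', hw, hres, hrest⟩, hrail, hstate, hprog⟩ := h'
  -- `Represents` and `CarriesOut` each name a place of the tape Worker on the strip; injectivity
  -- makes these the same.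
  obtain rfl := L.strip_injective (hp.symm.trans hp')
  refine ⟨_, by simp only [TuringMachine.step, machine, hc]; rfl, ?_, ⟨_, hw, fun i => ?_⟩, hstate, hprog⟩
  · have := L.railroads_lt P'
    simp only [Fin.val_ofNat]
    rw [← h₁, ← hrail, Int.toNat_natCast, Nat.mod_eq_of_lt this]
  · have h₀ := h₂ 0
    rw [add_zero] at h₀
    have key (j : ℤ) : P'.improvement (L.strip (p + j)) =
        (C.tape.write (c.tape.result C.tape.head)).nth j := by
      rw [Turing.Tape.write_nth]
      split_ifs with hj
      · rw [hj, add_zero, hres, h₀, Turing.Tape.nth_zero]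
      · rw [hrest _ (fun e => hj (by simpa using L.strip_injective e))
          (L.strip_notMem_reserved _), h₂]
    dsimp only
    cases c.dir with
    | left =>
      rw [Turing.Tape.move_left_nth, ← key]
      congr 2
      simp only [offset]
      ring
    | right =>
      rw [Turing.Tape.move_right_nth, ← key]
      congr 2
      simp only [offset]
      ring

/-- The state Worker walks within the area. -/
theorem play_walk {a b : L.area} (p : (hexGraph.induce L.area).Walk a b) {P : Position}
    (hP : P.worker .state = a) (ht : P.worker .tape ∉ L.area) :
    Play G S p.length P ⟨P.improvement, P.progress, Function.update P.worker .state b⟩ := by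
  induction p generalizing P with
  | nil =>
    rw [← hP, Function.update_eq_self]
    exact .nil P
  | @cons a a' b h p ih =>
    have hadj : hexGraph.Adj a.1 a'.1 := h
    have hlegal : Legal G S P .state (.move a') := by
      refine ⟨by rwa [hP], L.area_traversable a'.2, fun v hv => ?_⟩
      cases v with
      | tape => exact ht (hv ▸ a'.2)
      | state => exact hadj.ne (hP.symm.trans hv)
    have h' := ih (P := act S P .state (.move a')) (by simp [act]) (by simpa [act] using ht)
    rw [SimpleGraph.Walk.length_cons, Nat.add_comm]
    have := (Play.of_legal hlegal).trans h'
    simpa [act] using this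

/-- One walk is chosen for each of the finitely many pairs of reserved tiles; the longest of them
gives `D`, which depends on the layout alone. -/
theorem exists_walk_bound : ∃ D : ℕ, ∀ a ∈ L.reserved, ∀ b ∈ L.reserved, ∃ (ha : a ∈ L.area)
    (hb : b ∈ L.area) (p : (hexGraph.induce L.area).Walk ⟨a, ha⟩ ⟨b, hb⟩), p.length ≤ D := by
  have h (x : L.reserved × L.reserved) : ∃ n, ∃ p : (hexGraph.induce L.area).Walk
      ⟨x.1, L.reserved_subset x.1.2⟩ ⟨x.2, L.reserved_subset x.2.2⟩, p.length = n :=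
    let ⟨p⟩ := L.area_connected.preconnected ⟨x.1, L.reserved_subset x.1.2⟩
      ⟨x.2, L.reserved_subset x.2.2⟩
    ⟨_, p, rfl⟩
  choose f hf using h
  refine ⟨Finset.univ.sup f, fun a ha b hb => ?_⟩
  obtain ⟨p, hp⟩ := hf (⟨a, ha⟩, ⟨b, hb⟩)
  exact ⟨_, _, p, hp.trans_le (Finset.le_sup (Finset.mem_univ _))⟩

/-- From `P` to `P'`, only the state Worker has acted, on the reserved tiles, and no work is
unfinished. -/
def StateWork (P P' : Position) : Prop :=
  P'.worker .tape = P.worker .tape ∧ P'.worker .state ∈ L.reserved ∧ P'.progress = 0 ∧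
    ∀ t ∉ L.reserved, P'.improvement t = P.improvement t

/-- The state Worker goes to a reserved tile `t` and changes the improvement there. -/
theorem stateWork_update {P P' : Position} {t : Tile} {i : Improvement} (ht : t ∈ L.reserved)
    (hP' : P' = ⟨Function.update P.improvement t i, 0, Function.update P.worker .state t⟩) :
    L.StateWork P P' := by
  subst hP'
  refine ⟨by simp, by simpa using ht, rfl, fun u hu => ?_⟩
  exact Function.update_of_ne (by rintro rfl; exact hu ht) ..

theorem railroads_update (P : Position) {t : Tile} (ht : t ∈ L.reserved)
    (h : P.improvement t ≠ .railroad) (p) (w) :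
    L.railroads ⟨Function.update P.improvement t .railroad, p, w⟩ = L.railroads P + 1 := by
  rw [railroads, railroads, ← Finset.card_insert_of_notMem (a := t) (by simp [h])]
  congr 1
  ext u
  by_cases hu : u = t
  · subst hu; simp [ht]
  · simp [hu]

theorem railroads_update_remove (P : Position) {t : Tile} (ht : t ∈ L.reserved)
    (h : P.improvement t = .railroad) (p) (w) :
    L.railroads ⟨Function.update P.improvement t .noImprovement, p, w⟩ + 1 = L.railroads P := by
  rw [railroads, railroads, ← Finset.card_insert_of_notMem (a := t) (by simp)]
  congr 1
  ext u
  by_cases hu : u = t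
  · subst hu; simp [ht, h]
  · simp [hu]

variable {L} in
theorem StateWork.trans {P P' P'' : Position} (h : L.StateWork P P') (h' : L.StateWork P' P'') :
    L.StateWork P P'' :=
  ⟨h'.1.trans h.1, h'.2.1, h'.2.2.1, fun t ht => (h'.2.2.2 t ht).trans (h.2.2.2 t ht)⟩

/-- As long as fewer than nine Railroads stand, some reserved tile lacks one. A round consists of a
walk there and the building, possible also on top of a Road. -/
theorem exists_buildRailroads (hS : S.engineering) {D : ℕ}
    (hD : ∀ a ∈ L.reserved, ∀ b ∈ L.reserved, ∃ (ha : a ∈ L.area)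
      (hb : b ∈ L.area) (p : (hexGraph.induce L.area).Walk ⟨a, ha⟩ ⟨b, hb⟩), p.length ≤ D)
    (k : ℕ) {P : Position} (hw : P.worker .state ∈ L.reserved) (ht : P.worker .tape ∉ L.area)
    (h0 : P.progress = 0) (hk : L.railroads P + k ≤ 9) :
    ∃ n ≤ k * (D + max S.roadTurns S.railroadTurns), ∃ P', Play G S n P P' ∧ L.StateWork P P' ∧
      L.railroads P' = L.railroads P + k := by
  induction k with
  | zero => exact ⟨0, by simp, P, .nil P, ⟨rfl, hw, h0, fun _ _ => rfl⟩, rfl⟩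
  | succ k ih =>
    obtain ⟨n, hn, P₁, hP₁, hS₁, hr₁⟩ := ih (by omega)
    obtain ⟨t, htr, hti⟩ : ∃ t ∈ L.reserved, P₁.improvement t ≠ .railroad := by
      by_contra! hall
      have : L.railroads P₁ = 9 := by
        rw [railroads, Finset.filter_true_of_mem hall, L.reserved_card]
      omega
    obtain ⟨_, _, p, hp⟩ := hD _ hS₁.2.1 _ htr
    have hwalk := L.play_walk (S := S) p rfl (by rw [hS₁.1]; exact ht)
    obtain ⟨m, hm, hbuild⟩ := Play.exists_build (G := G) (S := S) (w := .state) (i := .railroad)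
      (P := ⟨P₁.improvement, P₁.progress, Function.update P₁.worker .state t⟩)
      ⟨hS, by simpa using hti⟩ hS₁.2.2.1
    simp only [Function.update_self] at hbuild
    refine ⟨n + (p.length + m), ?_, _, hP₁.trans (hwalk.trans hbuild),
      hS₁.trans (L.stateWork_update htr rfl), ?_⟩
    · rw [Nat.succ_mul]
      omega
    · rw [L.railroads_update P₁ htr hti, hr₁]
      omega

theorem exists_removeRailroads {D : ℕ}
    (hD : ∀ a ∈ L.reserved, ∀ b ∈ L.reserved, ∃ (ha : a ∈ L.area)
      (hb : b ∈ L.area) (p : (hexGraph.induce L.area).Walk ⟨a, ha⟩ ⟨b, hb⟩), p.length ≤ D)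
    (k : ℕ) {P : Position} (hw : P.worker .state ∈ L.reserved) (ht : P.worker .tape ∉ L.area)
    (h0 : P.progress = 0) (hk : k ≤ L.railroads P) :
    ∃ n ≤ k * (D + 1), ∃ P', Play G S n P P' ∧ L.StateWork P P' ∧
      L.railroads P' + k = L.railroads P := by
  induction k with
  | zero => exact ⟨0, by simp, P, .nil P, ⟨rfl, hw, h0, fun _ _ => rfl⟩, rfl⟩
  | succ k ih =>
    obtain ⟨n, hn, P₁, hP₁, hS₁, hr₁⟩ := ih (by omega)
    obtain ⟨t, htr⟩ := Finset.card_pos.1 (show 0 < L.railroads P₁ by omega)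
    obtain ⟨htr, hti⟩ := Finset.mem_filter.1 htr
    obtain ⟨_, _, p, hp⟩ := hD _ hS₁.2.1 _ htr
    have hwalk := L.play_walk (S := S) p rfl (by rw [hS₁.1]; exact ht)
    have hremove := Play.remove (G := G) (S := S) (w := .state)
      (P := ⟨P₁.improvement, P₁.progress, Function.update P₁.worker .state t⟩)
      (by simp [hti]) hS₁.2.2.1
    simp only [Function.update_self] at hremove
    refine ⟨n + (p.length + 1), ?_, _, hP₁.trans (hwalk.trans hremove),
      hS₁.trans (L.stateWork_update htr rfl), ?_⟩
    · rw [Nat.succ_mul]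
      omega
    · have := L.railroads_update_remove P₁ htr hti 0 (Function.update P₁.worker .state t)
      omega

/-- The tape Worker changes the improvement on its tile. -/
theorem exists_tapeOrder (hS : S.engineering) {P : Position} (h0 : P.progress = 0) (o : TapeOrder)
    (h₁ : o = .buildRoad → P.improvement (P.worker .tape) ≠ .road)
    (h₂ : o = .buildRailroad → P.improvement (P.worker .tape) ≠ .railroad)
    (h₃ : o = .remove → P.improvement (P.worker .tape) ≠ .noImprovement) :
    ∃ n ≤ 1 + max S.roadTurns S.railroadTurns, Play G S n P
      ⟨Function.update P.improvement (P.worker .tape)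
        (o.result (P.improvement (P.worker .tape))), 0, P.worker⟩ := by
  cases o with
  | keep =>
    refine ⟨0, by omega, ?_⟩
    rw [TapeOrder.result, Function.update_eq_self, ← h0]
    exact .nil P
  | buildRailroad =>
    obtain ⟨n, hn, h⟩ := Play.exists_build (G := G) (S := S) (P := P) (w := .tape) (i := .railroad)
      ⟨hS, h₂ rfl⟩ h0
    exact ⟨n, by omega, h⟩
  | remove => exact ⟨1, by omega, Play.remove (h₃ rfl) h0⟩
  | buildRoad =>
    by_cases hno : P.improvement (P.worker .tape) = .noImprovement
    · obtain ⟨n, hn, h⟩ := Play.exists_build (G := G) (S := S) (P := P) (w := .tape) (i := .road)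
        hno h0
      exact ⟨n, by omega, h⟩
    · have hr := Play.remove (G := G) (S := S) hno h0
      obtain ⟨n, hn, h⟩ := Play.exists_build (G := G) (S := S) (w := .tape) (i := .road)
        (P := ⟨Function.update P.improvement (P.worker .tape) .noImprovement, 0, P.worker⟩)
        (by simp [Legal]) rfl
      refine ⟨1 + n, by omega, ?_⟩
      have := hr.trans h
      rwa [Function.update_idem] at this

/-- A command is carried out within a number of turns that depends on the map only through `K`. -/
theorem exists_play_carriesOut : ∃ K : ℕ, ∀ S : Session, S.engineering → ∀ C P, L.Represents C P →
    ∀ c, L.command P = some c → ∃ n P', n ≤ 4 * max S.roadTurns S.railroadTurns + 1 + K ∧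
      Play G S n P P' ∧ L.CarriesOut c P P' := by
  obtain ⟨D, hD⟩ := L.exists_walk_bound
  -- With `B` the larger building time: at most `1 + B` turns for the tile, one for the move, and
  -- then `3 * (D + B)` for building or `5 * (D + 1)` for removing, both at most `3 * B + 5 * D +
  -- 5`. The Workers act one after the other.
  refine ⟨5 * D + 6, fun S hS C P hR c hc => ?_⟩
  obtain ⟨h₁, h₂, h₃, hge, hle, hq₀, hq₉⟩ := commandTable_spec _ _ _ hc
  obtain ⟨-, ⟨p, hp, -⟩, hstate, h0⟩ := hR
  obtain ⟨n₁, hn₁, hplay₁⟩ := exists_tapeOrder (G := G) hS h0 c.tape h₁ h₂ h₃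
  set P₁ : Position := ⟨Function.update P.improvement (P.worker .tape)
    (c.tape.result (P.improvement (P.worker .tape))), 0, P.worker⟩ with hP₁
  have hadj : hexGraph.Adj (L.strip p) (L.strip (p + offset c.dir)) := by
    cases c.dir with
    | left => simpa [offset, sub_eq_add_neg] using (L.strip_adj (p - 1)).symm
    | right => exact L.strip_adj p
  have hlegal : Legal G S P₁ .tape (.move (L.strip (p + offset c.dir))) := by
    refine ⟨by rwa [← hp] at hadj, L.strip_traversable _, fun v hv => ?_⟩
    cases v with
    | tape => exact hadj.ne (hp.symm.trans hv)
    | state => exact L.strip_notMem_reserved _ (hv ▸ hstate)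
  have hplay₂ := hplay₁.trans (Play.of_legal hlegal)
  set P₂ := act S P₁ .tape (.move (L.strip (p + offset c.dir))) with hP₂
  have hw₂ : P₂.worker .tape = L.strip (p + offset c.dir) := by simp [hP₂, act]
  have hs₂ : P₂.worker .state ∈ L.reserved := by simpa [hP₂, act, hP₁] using hstate
  have hi₂ : P₂.improvement = Function.update P.improvement (L.strip p)
      (c.tape.result (P.improvement (L.strip p))) := by simp [hP₂, act, hP₁, hp]
  have hr₂ : L.railroads P₂ = L.railroads P := L.railroads_congr fun t ht => by
    rw [hi₂, Function.update_of_ne]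
    rintro rfl
    exact L.strip_notMem_reserved p ht
  have hq₀ : 0 ≤ (L.railroads P : ℤ) + c.change := hq₀
  have hq₉ : (L.railroads P : ℤ) + c.change ≤ 9 := hq₉
  obtain ⟨n₃, hn₃, P₃, hplay₃, hS₃, hr₃⟩ : ∃ n ≤ 3 * max S.roadTurns S.railroadTurns + 5 * D + 5,
      ∃ P', Play G S n P₂ P' ∧ L.StateWork P₂ P' ∧
        (L.railroads P' : ℤ) = L.railroads P + c.change := by
    obtain ⟨k, hk | hk⟩ := Int.eq_nat_or_neg c.change
    · obtain ⟨n, hn, P', h⟩ := L.exists_buildRailroads hS hD k hs₂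
        (by rw [hw₂]; exact L.strip_notMem_area _) rfl (by omega)
      have : k * (D + max S.roadTurns S.railroadTurns) ≤
        3 * (D + max S.roadTurns S.railroadTurns) := Nat.mul_le_mul_right _ (by omega)
      exact ⟨n, by omega, P', h.1, h.2.1, by have := h.2.2; omega⟩
    · obtain ⟨n, hn, P', h⟩ := L.exists_removeRailroads (S := S) hD k hs₂
        (by rw [hw₂]; exact L.strip_notMem_area _) rfl (by omega)
      have : k * (D + 1) ≤ 5 * (D + 1) := Nat.mul_le_mul_right _ (by omega)
      exact ⟨n, by omega, P', h.1, h.2.1, by have := h.2.2; omega⟩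
  refine ⟨_, P₃, ?_, hplay₂.trans hplay₃, ⟨p, hp, hS₃.1.trans hw₂, ?_, fun t ht htr => ?_⟩, hr₃,
    hS₃.2.1, hS₃.2.2.1⟩
  · omega
  · rw [hS₃.2.2.2 _ (L.strip_notMem_reserved p), hi₂, Function.update_self]
  · rw [hS₃.2.2.2 t htr, hi₂, Function.update_of_ne ht]

end Layout

end CivV

/-! ### Assembly of the theorem -/

theorem theorem2 :
    -- ten states and three symbols
    Fintype.card (Fin 10) = 10 ∧ Fintype.card CivV.Improvement = 3 ∧
    -- the machine is universal
    CivV.machine.IsUniversal ∧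
    -- its program corresponds one-to-one to Rogozhin's
    Function.Bijective CivV.toRogozhin ∧
    (∀ (q : Fin 10) (s : CivV.Improvement),
      CivV.rogozhinProgram q (CivV.toRogozhin s) =
        (CivV.machine.δ q s).map fun a => (a.1, CivV.toRogozhin a.2.1, a.2.2)) ∧
    -- the game carries the machine, with constant overhead
    ∀ (G : CivV.GameMap) (L : CivV.Layout G),
      (∀ C, ∃ P, L.Represents C P) ∧
      ∃ K : ℕ, ∀ S : CivV.Session, S.engineering →
        ∀ C P, L.Represents C P →
          (CivV.machine.step C = none ↔ L.command P = none) ∧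
          ∀ c, L.command P = some c →
            (∃ n P', n ≤ 4 * max S.roadTurns S.railroadTurns + 1 + K ∧
              CivV.Play G S n P P' ∧ L.CarriesOut c P P') ∧
            ∀ P', L.CarriesOut c P P' →
              ∃ C', CivV.machine.step C = some C' ∧ L.Represents C' P' := by
  refine ⟨rfl, rfl, CivV.machine_isUniversal, ⟨?_, ?_⟩, ?_, fun G L => ⟨L.exists_represents, ?_⟩⟩
  · intro s t h
    cases s <;> cases t <;> first | rfl | cases h
  · rintro (_ | _ | _)
    exacts [⟨.noImprovement, rfl⟩, ⟨.road, rfl⟩, ⟨.railroad, rfl⟩]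
  · intro q s
    fin_cases q <;> cases s <;> rfl
  · obtain ⟨K, hK⟩ := L.exists_play_carriesOut
    refine ⟨K, fun S hS C P hR => ⟨?_, fun c hc => ⟨hK S hS C P hR c hc, fun P' hP' =>
      hR.of_carriesOut hc hP'⟩⟩⟩
    rw [hR.command_eq, TuringMachine.step, CivV.machine]
    simp
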